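/- Let $p>1$. For $L\ge 1$ let the red points be $r_i=i-\tfrac12$, $i=1,\dots,L$, and let the blue points be $L$ independent uniform random points of $[0,L]$. The cost of a bijection $\pi$ from red to blue points is $\sum_{i}|\pi(r_i)-r_i|^p$. For an optimal (cost-minimizing) matching $\pi$ put $\varphi_i=\pi(r_i)-r_i$ and $\sigma_i=\varphi_i/|\varphi_i|$ (with $\sigma_i=0$ if $\varphi_i=0$). For $s\in[0,1]$ let $\varphi(s)=\varphi_i$ and $\sigma(s)=\sigma_i$ if $s\in[\frac{i-1}{L},\frac iL)$, with $i=L$ for $s=1$, and let $x(s)=(\varphi(s)-\tfrac12)/\sqrt L$. For $a,b,c>0$ let $$G(a,b,c)=\int_{\mathbb R^2}\frac{\sqrt{\det A}}{2\pi}\,e^{-\frac12 (x,y)A(x,y)^T}\operatorname{sgn}(xy)\,dx\,dy,\qquad A=\begin{pmatrix}\frac1a+\frac1b&-\frac1b\\-\frac1b&\frac1c+\frac1b\end{pmatrix}.$$ Then: 1. Almost surely the blue points are distinct; and whenever they are distinct, there is exactly one optimal matching, which is also the only ordered one (the $i$-th red point from the left goes with the $i$-th blue point from the left). 2. As $L\to\infty$,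 the finite-dimensional distributions of $x$ converge to those of the standard Brownian bridge $B$ on $[0,1]$: for all $t_1,\dots,t_k\in[0,1]$, $(x(t_1),\dots,x(t_k))$ converges in law to $(B(t_1),\dots,B(t_k))$. Moreover $\mathbb E[\operatorname{sgn}(B(s)B(t))]=G(s,t-s,1-t)$ for $0<s<t<1$. 3. For $a,b,c>0$ with $a+b+c=1$, $\lim_{L\to\infty}\langle\sigma(a)\sigma(a+b)\rangle=G(a,b,c)$. 4. For all $a,b,c>0$ (without the constraint $a+b+c=1$), $$G(a,b,c)=\frac2\pi\arctan\sqrt{\frac{ac}{b(a+b+c)}}.$$ 5. For $0<b<1$, $$G_{\rm obc}(b):=\frac1{1-b}\int_0^{1-b}G(a,b,1-a-b)\,da=\frac{1-\sqrt b}{1+\sqrt b},$$ and this is the scaling limit of the averaged correlation: if $d_L\in\mathbb N$ and $d_L/L\to b$ as $L\to\infty$, then the average of $\langle\sigma_i\sigma_j\rangle$ over the pairs $(i,j)$ with $|r_i-r_j|=d_L$ converges to $G_{\rm obc}(b)$. -/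

import Mathlib

open MeasureTheory ProbabilityTheory Filter Topology Set
open scoped BigOperators unitInterval

noncomputable section

namespace GridPoisson

/-- The red points of the box `[0, L]`: the half-integers `1/2, 3/2, …, L - 1/2`, in increasing
order (indices start at `0`). -/
def red {L : ℕ} (i : Fin L) : ℝ := (i : ℝ) + 1 / 2

/-- The law of the `L` blue points: independent and uniform in `[0, L]`. -/
def blueLaw (L : ℕ) : Measure (Fin L → ℝ) :=
  Measure.pi fun _ => ProbabilityTheory.cond volume (Set.Icc (0 : ℝ) L)

instance isProbabilityMeasure_blueLaw (L : ℕ) : IsProbabilityMeasure (blueLaw L) := by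
  unfold blueLaw
  rcases Nat.eq_zero_or_pos L with rfl | hL
  · constructor
    simp
  · have : IsProbabilityMeasure
        (ProbabilityTheory.cond (volume : Measure ℝ) (Set.Icc (0 : ℝ) L)) := by
      refine ProbabilityTheory.cond_isProbabilityMeasure_of_finite ?_ ?_ <;>
        simp [Real.volume_Icc, hL.ne']
    infer_instance

/-- The cost of the matching in which the red point `i` goes with the blue point `b (π i)`; the
weight of an edge is the `p`-th power of the distance. -/
def cost (p : ℝ) {L : ℕ} (b : Fin L → ℝ) (π : Equiv.Perm (Fin L)) : ℝ :=
  ∑ i, |b (π i) - red i| ^ p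

/-- `π` has minimal cost among all matchings. -/
def IsOptimal (p : ℝ) {L : ℕ} (b : Fin L → ℝ) (π : Equiv.Perm (Fin L)) : Prop :=
  ∀ π' : Equiv.Perm (Fin L), cost p b π ≤ cost p b π'

/-- A matching is ordered if red points further to the right go with blue points further to the
right. -/
def IsOrdered {L : ℕ} (b : Fin L → ℝ) (π : Equiv.Perm (Fin L)) : Prop :=
  ∀ i j : Fin L, red i < red j → b (π i) < b (π j)

theorem exists_isOptimal (p : ℝ) {L : ℕ} (b : Fin L → ℝ) : ∃ π, IsOptimal p b π :=
  Finite.exists_min (cost p b)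

/-- An optimal matching. -/
def optimalMatching (p : ℝ) {L : ℕ} (b : Fin L → ℝ) : Equiv.Perm (Fin L) :=
  (exists_isOptimal p b).choose

/-- The displacement `φ_i` in the optimal matching. -/
def displacement (p : ℝ) {L : ℕ} (b : Fin L → ℝ) (i : Fin L) : ℝ :=
  b (optimalMatching p b i) - red i

/-- The spin `σ_i = φ_i / |φ_i|` (with value `0` if `φ_i = 0`). -/
def spin (p : ℝ) {L : ℕ} (b : Fin L → ℝ) (i : Fin L) : ℝ :=
  displacement p b i / |displacement p b i|

/-- The spin–spin correlation `⟨σ_i σ_j⟩`. -/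
def spinCorr (p : ℝ) (L : ℕ) (i j : Fin L) : ℝ :=
  ∫ b, spin p b i * spin p b j ∂(blueLaw L)

open Classical in
/-- The pairs of grid points at distance `r`. -/
def pairsAt (L r : ℕ) : Finset (Fin L × Fin L) :=
  Finset.univ.filter fun x => |red x.1 - red x.2| = r

/-- The correlation function averaged over the pairs of grid points at distance `r`. -/
def avgSpinCorr (p : ℝ) (L r : ℕ) : ℝ :=
  (∑ x ∈ pairsAt L r, spinCorr p L x.1 x.2) / (pairsAt L r).card

/-- The index of the grid point at rescaled time `s ∈ [0, 1]`: counting from `0`, it is `i` for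
`s ∈ [i / L, (i + 1) / L)`, and the last one for `s = 1`. -/
def timeIndex {L : ℕ} (hL : 0 < L) (s : ℝ) : Fin L :=
  ⟨min ⌊s * L⌋₊ (L - 1), by omega⟩

/-- The process `x(s)` with `φ(s) = √L x(s) + 1/2`, where `φ(s)` is the displacement at rescaled
time `s`. -/
def rescaledDisplacement (p : ℝ) {L : ℕ} (b : Fin L → ℝ) (s : ℝ) : ℝ :=
  if hL : 0 < L then (displacement p b (timeIndex hL s) - 1 / 2) / √(L : ℝ) else 0

/-- The spin–spin correlation `⟨σ(s) σ(t)⟩` at rescaled times `s`, `t`. -/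
def scaledSpinCorr (p : ℝ) (L : ℕ) (s t : ℝ) : ℝ :=
  if hL : 0 < L then spinCorr p L (timeIndex hL s) (timeIndex hL t) else 0

/-- Standard Brownian bridge on `[0, 1]`: the centred Gaussian process with covariance
`min s t - s t` and almost surely continuous paths. -/
structure IsBrownianBridge {Ω : Type*} [MeasurableSpace Ω] (B : I → Ω → ℝ) (P : Measure Ω) :
    Prop where
  isGaussianProcess : IsGaussianProcess B P
  integral_eq_zero : ∀ t, ∫ ω, B t ω ∂P = 0
  covariance_eq : ∀ s t : I, cov[B s, B t; P] = min (s : ℝ) t - s * t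
  continuous_paths : ∀ᵐ ω ∂P, Continuous fun t => B t ω

/-- The inverse covariance matrix of the bridge at the two inner endpoints of consecutive segments
of lengths `a`, `b`, `c`. -/
def matA (a b c : ℝ) : Matrix (Fin 2) (Fin 2) ℝ :=
  !![1 / a + 1 / b, -(1 / b); -(1 / b), 1 / c + 1 / b]

/-- The centred Gaussian density with inverse covariance matrix `matA a b c`. -/
def density (a b c x y : ℝ) : ℝ :=
  √(matA a b c).det * Real.exp (-(1 / 2) * (![x, y] ⬝ᵥ (matA a b c).mulVec ![x, y])) /
    (2 * Real.pi)

/-- The continuum correlation function `G(a, b, c)`: the expectation of `sgn (x y)` under the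
Gaussian density. -/
def G (a b c : ℝ) : ℝ :=
  ∫ z : ℝ × ℝ, density a b c z.1 z.2 * Real.sign (z.1 * z.2)

/-- The mean of the continuum correlation function over the positions, at fixed separation. -/
def Gobc (b : ℝ) : ℝ :=
  1 / (1 - b) * ∫ a in (0 : ℝ)..(1 - b), G a b (1 - a - b)

end GridPoisson

end

namespace GridPoisson

/-! Since `|x| ^ p` is strictly convex for `p > 1`, uncrossing two edges strictly lowers the cost.
Finiteness gives an optimal matching, so for distinct blue points it must be the sorting
permutation. Displacements are then order statistics minus grid points, and the rest is about the
uniform quantile process.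

All sizes `L` are realised on one space of i.i.d. uniform points. An order statistic exceeds a level
exactly when few points lie below that level, so the rescaled displacement is asymptotically minus
the empirical fluctuation of the indicator `below t`: the random threshold is replaced by `t` at a
cost controlled by the variance of a difference of indicators, and a grid argument turns estimates
at fixed levels into convergence in measure (`tendstoInMeasure_quantileFluct_add_fluct`). The
empirical fluctuations converge jointly by the central limit theorem and the Cramér-Wold device;
indicators have covariance `min s t - s t`, that of the bridge. Only the linear combinations matter,
so the limit is described by `IsBridgeVector`, which covers both a given bridge and an explicit
Gaussian pair.

The sign of a product is discontinuous only where a coordinate vanishes, a null event for the limit,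
so spin correlations converge along any index sequences with `i / L` and `j / L` convergent to
interior times. This freedom lets the average over positions be treated as an integral over `[0, 1]`
by dominated convergence.

For the closed form, the substitution `y = x v` reduces the sign integral of a planar Gaussian to a
rational integral in `v`, hence to an arctangent. Its mean over positions has an elementary
primitive. -/

/-! ### Optimal matchings and uncrossing -/

theorem strictConvexOn_abs_rpow {p : ℝ} (hp : 1 < p) :
    StrictConvexOn ℝ univ fun x : ℝ => |x| ^ p := by
  have hc := strictConvexOn_rpow hp
  refine ⟨convex_univ, fun x _ y _ hxy a b ha hb hab => ?_⟩
  simp only [smul_eq_mul]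
  have habs : |a * x + b * y| ≤ a * |x| + b * |y| := by
    refine (abs_add_le _ _).trans_eq ?_
    rw [abs_mul, abs_mul, abs_of_pos ha, abs_of_pos hb]
  -- Strict convexity of the power on `[0, ∞)` settles distinct absolute values. Otherwise `x = -y`,
  -- and strictness comes from cancellation inside the absolute value.
  rcases eq_or_ne |x| |y| with h | h
  · have hyx : x = -y := (abs_eq_abs.mp h).resolve_left hxy
    have hy : y ≠ 0 := by
      rintro rfl
      simp [hyx] at hxy
    have hlt : |a * x + b * y| < |y| := by
      have : a * x + b * y = (b - a) * y := by rw [hyx]; ring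
      rw [this, abs_mul]
      refine mul_lt_of_lt_one_left (abs_pos.mpr hy) (abs_lt.mpr ⟨?_, ?_⟩) <;> linarith
    calc |a * x + b * y| ^ p < |y| ^ p :=
          Real.rpow_lt_rpow (abs_nonneg _) hlt (by linarith)
      _ = a * |x| ^ p + b * |y| ^ p := by rw [h, ← add_mul, hab, one_mul]
  · calc |a * x + b * y| ^ p ≤ (a * |x| + b * |y|) ^ p :=
          Real.rpow_le_rpow (abs_nonneg _) habs (by linarith)
      _ < a * |x| ^ p + b * |y| ^ p := by
          simpa using hc.2 (abs_nonneg x) (abs_nonneg y) h ha hb hab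

/-- The lengths `y - r` and `y' - r'` are convex combinations of `y - r'` and `y' - r` with
interchanged weights, so the two convexity inequalities add up to the claim. -/
theorem abs_sub_rpow_add_lt_of_crossing {p r r' y y' : ℝ} (hp : 1 < p) (hr : r < r')
    (hy : y < y') :
    |y - r| ^ p + |y' - r'| ^ p < |y' - r| ^ p + |y - r'| ^ p := by
  have hD : 0 < (y' - y) + (r' - r) := by linarith
  set D := (y' - y) + (r' - r) with hDdef
  have ha : 0 < (y' - y) / D := div_pos (by linarith) hD
  have hb : 0 < (r' - r) / D := div_pos (by linarith) hD
  have hab : (y' - y) / D + (r' - r) / D = 1 := by rw [← add_div, div_self hD.ne']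
  have hne : y - r' ≠ y' - r := by intro h; linarith
  have hf := strictConvexOn_abs_rpow hp
  have h1 := hf.2 (mem_univ (y - r')) (mem_univ (y' - r)) hne ha hb hab
  have h2 := hf.2 (mem_univ (y - r')) (mem_univ (y' - r)) hne hb ha (by linarith)
  simp only [smul_eq_mul] at h1 h2
  have e1 : (y' - y) / D * (y - r') + (r' - r) / D * (y' - r) = y - r := by
    field_simp
    rw [hDdef]
    ring
  have e2 : (r' - r) / D * (y - r') + (y' - y) / D * (y' - r) = y' - r' := by
    field_simp
    rw [hDdef]
    ring
  rw [e1] at h1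
  rw [e2] at h2
  have h3 : ∀ u v : ℝ, (y' - y) / D * u + (r' - r) / D * v + ((r' - r) / D * u + (y' - y) / D * v)
      = v + u := by
    intro u v
    calc _ = ((y' - y) / D + (r' - r) / D) * (v + u) := by ring
      _ = _ := by rw [hab, one_mul]
  linarith [h3 (|y - r'| ^ p) (|y' - r| ^ p)]

theorem red_lt_red {L : ℕ} {i j : Fin L} : red i < red j ↔ i < j := by
  rw [red, red, add_lt_add_iff_right, Nat.cast_lt, Fin.lt_def]

theorem isOrdered_iff_strictMono {L : ℕ} {b : Fin L → ℝ} {π : Equiv.Perm (Fin L)} :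
    IsOrdered b π ↔ StrictMono (b ∘ π) := by
  simp [IsOrdered, red_lt_red, StrictMono]

theorem cost_swap_lt {p : ℝ} (hp : 1 < p) {L : ℕ} {b : Fin L → ℝ} {π : Equiv.Perm (Fin L)}
    {i j : Fin L} (hij : i < j) (h : b (π j) < b (π i)) :
    cost p b (π * Equiv.swap i j) < cost p b π := by
  unfold cost
  have hj : j ∈ Finset.univ.erase i := by simp [hij.ne']
  rw [← Finset.add_sum_erase _ _ (Finset.mem_univ i), ← Finset.add_sum_erase _ _ hj,
    ← Finset.add_sum_erase (a := i) Finset.univ (fun k => |b (π k) - red k| ^ p)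
      (Finset.mem_univ i), ← Finset.add_sum_erase _ (fun k => |b (π k) - red k| ^ p) hj,
    ← add_assoc, ← add_assoc]
  refine add_lt_add_of_lt_of_le ?_ (Finset.sum_le_sum fun k hk => ?_)
  · simpa using abs_sub_rpow_add_lt_of_crossing hp (red_lt_red.mpr hij) h
  · simp only [Finset.mem_erase, Finset.mem_univ, and_true] at hk
    rw [Equiv.Perm.mul_apply, Equiv.swap_apply_of_ne_of_ne hk.2 hk.1]

theorem IsOptimal.isOrdered {p : ℝ} (hp : 1 < p) {L : ℕ} {b : Fin L → ℝ}
    (hb : Function.Injective b) {π : Equiv.Perm (Fin L)} (h : IsOptimal p b π) :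
    IsOrdered b π := by
  intro i j hij
  rw [red_lt_red] at hij
  by_contra! hlt
  refine (h (π * Equiv.swap i j)).not_gt (cost_swap_lt hp hij (hlt.lt_of_ne fun he => ?_))
  exact hij.ne' (π.injective (hb he))

theorem isOrdered_sort {L : ℕ} {b : Fin L → ℝ} (hb : Function.Injective b) :
    IsOrdered b (Tuple.sort b) :=
  isOrdered_iff_strictMono.mpr
    ((Tuple.monotone_sort b).strictMono_of_injective (hb.comp (Tuple.sort b).injective))

theorem isOrdered_iff_eq_sort {L : ℕ} {b : Fin L → ℝ} (hb : Function.Injective b)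
    {π : Equiv.Perm (Fin L)} : IsOrdered b π ↔ π = Tuple.sort b := by
  refine ⟨fun h => ?_, fun h => h ▸ isOrdered_sort hb⟩
  have := Tuple.unique_monotone (isOrdered_iff_strictMono.mp h).monotone (Tuple.monotone_sort b)
  exact Equiv.ext fun i => hb (congrFun this i)

theorem isOptimal_iff_eq_sort {p : ℝ} (hp : 1 < p) {L : ℕ} {b : Fin L → ℝ}
    (hb : Function.Injective b) {π : Equiv.Perm (Fin L)} :
    IsOptimal p b π ↔ π = Tuple.sort b := by
  have key : ∀ π', IsOptimal p b π' → π' = Tuple.sort b := fun π' h =>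
    (isOrdered_iff_eq_sort hb).mp (h.isOrdered hp hb)
  refine ⟨key π, ?_⟩
  rintro rfl
  -- The sorting permutation is optimal because some optimum exists and every optimum equals it.
  obtain ⟨π', h⟩ := exists_isOptimal p b
  exact key π' h ▸ h

/-! ### Order statistics and almost sure distinctness -/

/-- The `i`-th order statistic of the blue points. -/
noncomputable def orderStat {L : ℕ} (b : Fin L → ℝ) (i : Fin L) : ℝ := b (Tuple.sort b i)

theorem displacement_eq_orderStat_sub {p : ℝ} (hp : 1 < p) {L : ℕ} {b : Fin L → ℝ}
    (hb : Function.Injective b) (i : Fin L) : displacement p b i = orderStat b i - red i := by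
  have h : optimalMatching p b = Tuple.sort b :=
    (isOptimal_iff_eq_sort hp hb).mp (exists_isOptimal p b).choose_spec
  rw [displacement, orderStat, h]

/-- Sorting only permutes the points, so it preserves the count. This duality between quantiles and
counts yields both measurability and the comparison with the empirical process. -/
theorem orderStat_le_iff {L : ℕ} (b : Fin L → ℝ) (i : Fin L) (x : ℝ) :
    orderStat b i ≤ x ↔ (i : ℕ) < (Finset.univ.filter fun j => b j ≤ x).card := by
  have h := Tuple.lt_card_le_iff_apply_le_of_monotone (j := i) (a := x) (Tuple.monotone_sort b)
  rw [orderStat, ← Function.comp_apply (f := b), ← h]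
  rw [Finset.card_equiv (Tuple.sort b) (t := Finset.univ.filter fun j => b j ≤ x) (by simp)]

theorem measurable_orderStat {L : ℕ} (i : Fin L) :
    Measurable fun b : Fin L → ℝ => orderStat b i := by
  refine measurable_of_Iic fun x => ?_
  have : (fun b : Fin L → ℝ => orderStat b i) ⁻¹' Iic x =
      {b | (i : ℝ) < ∑ j, (Iic x).indicator (fun _ => (1 : ℝ)) (b j)} := by
    ext b
    simp only [mem_preimage, mem_Iic, mem_ofPred_eq, orderStat_le_iff]
    rw [← Nat.cast_lt (α := ℝ), Finset.card_filter]
    simp [indicator_apply]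
  rw [this]
  refine measurableSet_lt measurable_const (Finset.measurable_sum _ fun j _ => ?_)
  exact (measurable_const.indicator measurableSet_Iic).comp (measurable_pi_apply j)

theorem ae_injective_blueLaw (L : ℕ) : ∀ᵐ b ∂(blueLaw L), Function.Injective b := by
  rcases Nat.eq_zero_or_pos L with rfl | hL
  · exact Eventually.of_forall fun b => Function.injective_of_subsingleton b
  have hpr : IsProbabilityMeasure
      (ProbabilityTheory.cond (volume : Measure ℝ) (Set.Icc (0 : ℝ) L)) := by
    refine ProbabilityTheory.cond_isProbabilityMeasure_of_finite ?_ ?_ <;>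
      simp [Real.volume_Icc, hL.ne']
  set μ := ProbabilityTheory.cond (volume : Measure ℝ) (Set.Icc (0 : ℝ) L) with hμ
  have hac : μ ≪ volume := ProbabilityTheory.cond_absolutelyContinuous
  have hind : iIndepFun (fun (i : Fin L) (b : Fin L → ℝ) => b i) (blueLaw L) :=
    iIndepFun_pi (X := fun _ x => x) fun i => aemeasurable_id
  have hne : ∀ i j : Fin L, i ≠ j → ∀ᵐ b ∂(blueLaw L), b i ≠ b j := by
    intro i j hij
    have h := (indepFun_iff_map_prod_eq_prod_map_map (measurable_pi_apply i).aemeasurable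
      (measurable_pi_apply j).aemeasurable).mp
      (hind.indepFun hij)
    have hm : ∀ k : Fin L, Measure.map (fun b : Fin L → ℝ => b k) (blueLaw L) = μ := fun k =>
      (measurePreserving_eval (fun _ : Fin L => μ) k).map_eq
    rw [hm, hm] at h
    have hdiag : MeasurableSet {z : ℝ × ℝ | z.1 = z.2} :=
      measurableSet_eq_fun measurable_fst measurable_snd
    have hz : (μ.prod μ) {z : ℝ × ℝ | z.1 = z.2} = 0 := by
      rw [Measure.measure_prod_null hdiag]
      refine Eventually.of_forall fun x => hac ?_
      have : Prod.mk x ⁻¹' {z : ℝ × ℝ | z.1 = z.2} = {x} := by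
        ext y; simp [eq_comm]
      rw [this]
      simp
    rw [← h, Measure.map_apply (by fun_prop) hdiag] at hz
    exact measure_eq_zero_iff_ae_notMem.mp hz
  have hall : ∀ᵐ b ∂(blueLaw L), ∀ i j : Fin L, i ≠ j → b i ≠ b j := by
    simp only [ae_all_iff]
    exact hne
  filter_upwards [hall] with b hb i j hij
  by_contra hc
  exact hb i j hc hij

/-! ### The sign integral of a planar Gaussian and the closed form of `G` -/

theorem hasDerivAt_exp_neg_sq_mul {q : ℝ} (hq : 0 < q) (x : ℝ) :
    HasDerivAt (fun x : ℝ => -(1 / q) * Real.exp (-(x ^ 2 * q) / 2))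
      (x * Real.exp (-(x ^ 2 * q) / 2)) x := by
  have h : HasDerivAt (fun x : ℝ => -(x ^ 2 * q) / 2) (-(2 * x * q) / 2) x := by
    simpa using (((hasDerivAt_pow 2 x).mul_const q).neg).div_const 2
  exact (h.exp.const_mul (-(1 / q))).congr_deriv (by field_simp)

theorem integrable_abs_mul_exp_neg_sq_mul {q : ℝ} (hq : 0 < q) :
    Integrable fun x : ℝ => |x| * Real.exp (-(x ^ 2 * q) / 2) := by
  have h := (integrable_mul_exp_neg_mul_sq (half_pos hq)).abs
  refine h.congr (Eventually.of_forall fun x => ?_)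
  simp only [abs_mul, Real.abs_exp]
  ring_nf

theorem integral_abs_mul_exp_neg_sq_mul {q : ℝ} (hq : 0 < q) :
    ∫ x : ℝ, |x| * Real.exp (-(x ^ 2 * q) / 2) = 2 / q := by
  have h1 := integral_comp_abs (f := fun x : ℝ => x * Real.exp (-(x ^ 2 * q) / 2))
  simp only [sq_abs] at h1
  rw [h1]
  have hint : IntegrableOn (fun x : ℝ => x * Real.exp (-(x ^ 2 * q) / 2)) (Ioi 0) := by
    refine (integrable_abs_mul_exp_neg_sq_mul hq).integrableOn.congr_fun (fun x hx => ?_)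
      measurableSet_Ioi
    simp only [abs_of_pos (mem_Ioi.mp hx)]
  have hlim : Tendsto (fun x : ℝ => -(1 / q) * Real.exp (-(x ^ 2 * q) / 2)) atTop (𝓝 0) := by
    rw [← mul_zero (-(1 / q))]
    refine (Real.tendsto_exp_atBot.comp ?_).const_mul _
    have : Tendsto (fun x : ℝ => x ^ 2 * (q / 2)) atTop atTop :=
      (tendsto_pow_atTop two_ne_zero).atTop_mul_const (half_pos hq)
    refine (tendsto_neg_atTop_atBot.comp this).congr fun x => ?_
    simp only [Function.comp]
    ring
  rw [integral_Ioi_of_hasDerivAt_of_tendsto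
    (hasDerivAt_exp_neg_sq_mul hq 0).continuousAt.continuousWithinAt
    (fun x _ => hasDerivAt_exp_neg_sq_mul hq x) hint hlim]
  simp
  ring

theorem sign_mul_mul_self {x : ℝ} (hx : x ≠ 0) (v : ℝ) : Real.sign (x * (x * v)) = Real.sign v := by
  have h : 0 < x * x := mul_self_pos.mpr hx
  rw [← mul_assoc]
  rcases lt_trichotomy v 0 with hv | rfl | hv
  · rw [Real.sign_of_neg hv, Real.sign_of_neg (mul_neg_of_pos_of_neg h hv)]
  · simp
  · rw [Real.sign_of_pos hv, Real.sign_of_pos (mul_pos h hv)]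

theorem abs_sign_le_one (x : ℝ) : |Real.sign x| ≤ 1 := by
  rcases Real.sign_apply_eq x with h | h | h <;> simp [h]

theorem measurable_sign : Measurable Real.sign := by
  unfold Real.sign
  exact Measurable.ite measurableSet_Iio measurable_const
    (Measurable.ite measurableSet_Ioi measurable_const measurable_const)

section Quadratic

variable {P Q R D : ℝ}

theorem mul_quadratic_eq (h : D ^ 2 = P * Q - R ^ 2) (v : ℝ) :
    Q * (P + Q * v ^ 2 - 2 * R * v) = (Q * v - R) ^ 2 + D ^ 2 := by
  rw [h]; ring

theorem quadratic_pos (hQ : 0 < Q) (hD : 0 < D) (h : D ^ 2 = P * Q - R ^ 2) (v : ℝ) :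
    0 < P + Q * v ^ 2 - 2 * R * v := by
  have := mul_quadratic_eq h v
  by_contra! hc
  nlinarith [sq_nonneg (Q * v - R), sq_pos_of_pos hD]

theorem two_div_quadratic_eq (hQ : 0 < Q) (hD : 0 < D) (h : D ^ 2 = P * Q - R ^ 2) (v : ℝ) :
    2 / (P + Q * v ^ 2 - 2 * R * v) =
      2 * Q / D ^ 2 * (1 + (Q / D * v - R / D) ^ 2)⁻¹ := by
  have h1 := mul_quadratic_eq h v
  have h2 := quadratic_pos hQ hD h v
  have h3 : 1 + (Q / D * v - R / D) ^ 2 = Q * (P + Q * v ^ 2 - 2 * R * v) / D ^ 2 := by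
    rw [h1]
    field_simp
    ring
  rw [h3]
  field_simp

theorem integrable_two_div_quadratic (hQ : 0 < Q) (hD : 0 < D) (h : D ^ 2 = P * Q - R ^ 2) :
    Integrable fun v : ℝ => 2 / (P + Q * v ^ 2 - 2 * R * v) := by
  simp only [two_div_quadratic_eq hQ hD h]
  exact ((integrable_inv_one_add_sq.comp_sub_right (R / D)).comp_mul_left'
    (div_pos hQ hD).ne').const_mul _

theorem hasDerivAt_arctan_quadratic (hQ : 0 < Q) (hD : 0 < D) (h : D ^ 2 = P * Q - R ^ 2)
    (v : ℝ) :
    HasDerivAt (fun v : ℝ => 2 / D * Real.arctan (Q / D * v - R / D))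
      (2 / (P + Q * v ^ 2 - 2 * R * v)) v := by
  rw [two_div_quadratic_eq hQ hD h]
  have h1 : HasDerivAt (fun v : ℝ => Q / D * v - R / D) (Q / D) v := by
    simpa using ((hasDerivAt_id v).const_mul (Q / D)).sub_const (R / D)
  exact (h1.arctan.const_mul (2 / D)).congr_deriv (by field_simp)

theorem integral_sign_mul_two_div_quadratic (hQ : 0 < Q) (hD : 0 < D)
    (h : D ^ 2 = P * Q - R ^ 2) :
    ∫ v : ℝ, Real.sign v * (2 / (P + Q * v ^ 2 - 2 * R * v)) =
      4 / D * Real.arctan (R / D) := by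
  have hi := integrable_two_div_quadratic hQ hD h
  have hi' : Integrable fun v : ℝ => Real.sign v * (2 / (P + Q * v ^ 2 - 2 * R * v)) :=
    hi.bdd_mul measurable_sign.aestronglyMeasurable
      (Eventually.of_forall fun v => abs_sign_le_one v)
  have hd := hasDerivAt_arctan_quadratic hQ hD h
  have hcts : ∀ s, ContinuousWithinAt
      (fun v : ℝ => 2 / D * Real.arctan (Q / D * v - R / D)) s 0 :=
    fun s => (hd 0).continuousAt.continuousWithinAt
  have htop : Tendsto (fun v : ℝ => 2 / D * Real.arctan (Q / D * v - R / D)) atTop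
      (𝓝 (2 / D * (Real.pi / 2))) := by
    refine ((Real.tendsto_arctan_atTop.mono_right nhdsWithin_le_nhds).comp ?_).const_mul _
    exact tendsto_atTop_add_const_right _ (-(R / D)) (tendsto_id.const_mul_atTop (div_pos hQ hD))
  have hbot : Tendsto (fun v : ℝ => 2 / D * Real.arctan (Q / D * v - R / D)) atBot
      (𝓝 (2 / D * (-(Real.pi / 2)))) := by
    refine ((Real.tendsto_arctan_atBot.mono_right nhdsWithin_le_nhds).comp ?_).const_mul _
    exact tendsto_atBot_add_const_right _ (-(R / D)) (tendsto_id.const_mul_atBot (div_pos hQ hD))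
  have e1 : ∫ v in Ioi (0 : ℝ), Real.sign v * (2 / (P + Q * v ^ 2 - 2 * R * v)) =
      2 / D * (Real.pi / 2) - 2 / D * Real.arctan (Q / D * 0 - R / D) := by
    rw [← integral_Ioi_of_hasDerivAt_of_tendsto (hcts _) (fun v _ => hd v) hi.integrableOn htop]
    refine setIntegral_congr_fun measurableSet_Ioi fun v hv => ?_
    simp only [Real.sign_of_pos (mem_Ioi.mp hv), one_mul]
  have e2 : ∫ v in Iic (0 : ℝ), Real.sign v * (2 / (P + Q * v ^ 2 - 2 * R * v)) =
      -(2 / D * Real.arctan (Q / D * 0 - R / D) - 2 / D * (-(Real.pi / 2))) := by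
    rw [← integral_Iic_of_hasDerivAt_of_tendsto (hcts _) (fun v _ => hd v) hi.integrableOn hbot,
      integral_Iic_eq_integral_Iio, integral_Iic_eq_integral_Iio, ← integral_neg]
    refine setIntegral_congr_fun measurableSet_Iio fun v hv => ?_
    simp only [Real.sign_of_neg (mem_Iio.mp hv), neg_one_mul]
  rw [← intervalIntegral.integral_Iic_add_Ioi hi'.integrableOn hi'.integrableOn (b := 0), e1, e2]
  have : Q / D * 0 - R / D = -(R / D) := by ring
  rw [this, Real.arctan_neg]
  ring

/-- In the coordinates `(x, v)` with `y = x v` the sign depends on `v` alone, and the `x`-integral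
of the absolute value is `2 / q v`, which is integrable. This justifies exchanging the integrals. -/
theorem integral_integral_exp_quadratic_mul_sign (hQ : 0 < Q) (hD : 0 < D)
    (h : D ^ 2 = P * Q - R ^ 2) :
    ∫ x : ℝ, ∫ y : ℝ, Real.exp (-(P * x ^ 2 + Q * y ^ 2 - 2 * R * (x * y)) / 2) *
      Real.sign (x * y) = 4 / D * Real.arctan (R / D) := by
  set q : ℝ → ℝ := fun v => P + Q * v ^ 2 - 2 * R * v with hq
  have hqpos : ∀ v, 0 < q v := quadratic_pos hQ hD h
  have hcont : Continuous q := by fun_prop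
  have hinner : ∀ᵐ x : ℝ, ∫ y : ℝ,
      Real.exp (-(P * x ^ 2 + Q * y ^ 2 - 2 * R * (x * y)) / 2) * Real.sign (x * y) =
      ∫ v : ℝ, Real.sign v * (|x| * Real.exp (-(x ^ 2 * q v) / 2)) := by
    filter_upwards [compl_mem_ae_iff.mpr (measure_singleton (0 : ℝ))] with x hx
    have hx : x ≠ 0 := hx
    -- The substitution `y = x v` has Jacobian `|x|`; the excluded point `x = 0` is null.
    have hs := Measure.integral_comp_mul_left (fun y : ℝ =>
      Real.exp (-(P * x ^ 2 + Q * y ^ 2 - 2 * R * (x * y)) / 2) * Real.sign (x * y)) x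
    rw [smul_eq_mul, abs_inv, eq_comm, inv_mul_eq_iff_eq_mul₀ (abs_ne_zero.mpr hx)] at hs
    rw [hs, ← integral_const_mul]
    refine integral_congr_ae (Eventually.of_forall fun v => ?_)
    simp only [sign_mul_mul_self hx, hq]
    rw [show -(P * x ^ 2 + Q * (x * v) ^ 2 - 2 * R * (x * (x * v))) / 2 =
      -(x ^ 2 * (P + Q * v ^ 2 - 2 * R * v)) / 2 by ring]
    ring
  rw [integral_congr_ae hinner, integral_integral_swap]
  · rw [← integral_sign_mul_two_div_quadratic hQ hD h]
    refine integral_congr_ae (Eventually.of_forall fun v => ?_)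
    simp only
    rw [integral_const_mul, integral_abs_mul_exp_neg_sq_mul (hqpos v)]
  · have hmeas : AEStronglyMeasurable
        (Function.uncurry fun x v : ℝ => Real.sign v * (|x| * Real.exp (-(x ^ 2 * q v) / 2)))
        (volume.prod volume) := by
      refine Measurable.aestronglyMeasurable (Measurable.mul ?_ ?_)
      · exact measurable_sign.comp measurable_snd
      · exact Continuous.measurable (by fun_prop)
    have hbase : Integrable
        (Function.uncurry fun x v : ℝ => |x| * Real.exp (-(x ^ 2 * q v) / 2))
        (volume.prod volume) := by
      rw [integrable_prod_iff' (Continuous.aestronglyMeasurable (by fun_prop))]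
      refine ⟨Eventually.of_forall fun v => integrable_abs_mul_exp_neg_sq_mul (hqpos v), ?_⟩
      refine (integrable_two_div_quadratic hQ hD h).congr (Eventually.of_forall fun v => ?_)
      simp only [Function.uncurry_apply_pair, Real.norm_eq_abs, abs_mul, abs_abs, Real.abs_exp]
      exact (integral_abs_mul_exp_neg_sq_mul (hqpos v)).symm
    refine hbase.mono hmeas (Eventually.of_forall fun z => ?_)
    simp only [Function.uncurry, norm_mul]
    exact mul_le_of_le_one_left (by positivity) (abs_sign_le_one _)

theorem integrable_exp_quadratic (hP : 0 < P) (hQ : 0 < Q) (hD : 0 < D)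
    (h : D ^ 2 = P * Q - R ^ 2) :
    Integrable fun z : ℝ × ℝ =>
      Real.exp (-(P * z.1 ^ 2 + Q * z.2 ^ 2 - 2 * R * (z.1 * z.2)) / 2) := by
  have hD2 := sq_pos_of_pos hD
  -- Determinant over trace bounds the smallest eigenvalue from below: subtracting `ε` from the
  -- diagonal leaves determinant `ε ^ 2`.
  set ε := D ^ 2 / (P + Q) with hε
  have hεpos : 0 < ε := by positivity
  have hεmul : ε * (P + Q) = D ^ 2 := div_mul_cancel₀ _ (by positivity)
  have hPε : 0 < P - ε := by
    rw [sub_pos, hε, div_lt_iff₀ (by positivity)]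
    nlinarith [sq_nonneg R, mul_pos hP hP]
  have hlow : ∀ x y : ℝ, ε * x ^ 2 + ε * y ^ 2 ≤ P * x ^ 2 + Q * y ^ 2 - 2 * R * (x * y) := by
    intro x y
    have hdet : 0 ≤ (P - ε) * (Q - ε) - R ^ 2 := by nlinarith
    have key : (P - ε) * (P * x ^ 2 + Q * y ^ 2 - 2 * R * (x * y) - (ε * x ^ 2 + ε * y ^ 2)) =
        ((P - ε) * x - R * y) ^ 2 + ((P - ε) * (Q - ε) - R ^ 2) * y ^ 2 := by ring
    have : 0 ≤ P * x ^ 2 + Q * y ^ 2 - 2 * R * (x * y) - (ε * x ^ 2 + ε * y ^ 2) := by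
      refine nonneg_of_mul_nonneg_right (key ▸ ?_) hPε
      positivity
    linarith
  have hg : Integrable fun x : ℝ => Real.exp (-(ε / 2) * x ^ 2) :=
    integrable_exp_neg_mul_sq (half_pos hεpos)
  refine (hg.mul_prod hg).mono' (Continuous.aestronglyMeasurable (by fun_prop))
    (Eventually.of_forall fun z => ?_)
  rw [Real.norm_eq_abs, Real.abs_exp, ← Real.exp_add, Real.exp_le_exp]
  linarith [hlow z.1 z.2]

theorem integral_exp_quadratic_mul_sign (hP : 0 < P) (hQ : 0 < Q) (hD : 0 < D)
    (h : D ^ 2 = P * Q - R ^ 2) :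
    ∫ z : ℝ × ℝ, Real.exp (-(P * z.1 ^ 2 + Q * z.2 ^ 2 - 2 * R * (z.1 * z.2)) / 2) *
      Real.sign (z.1 * z.2) = 4 / D * Real.arctan (R / D) := by
  rw [← integral_integral_exp_quadratic_mul_sign hQ hD h, Measure.volume_eq_prod, integral_prod]
  refine (integrable_exp_quadratic hP hQ hD h).mul_bdd (c := 1)
    (measurable_sign.comp (measurable_fst.mul measurable_snd)).aestronglyMeasurable
    (Eventually.of_forall fun z => abs_sign_le_one _)

end Quadratic

theorem G_eq {a b c : ℝ} (ha : 0 < a) (hb : 0 < b) (hc : 0 < c) :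
    G a b c = 2 / Real.pi * Real.arctan √(a * c / (b * (a + b + c))) := by
  have hdet : (matA a b c).det = (a + b + c) / (a * b * c) := by
    rw [matA, Matrix.det_fin_two_of]
    field_simp
    ring
  have hdpos : 0 < (matA a b c).det := by rw [hdet]; positivity
  set D := √(matA a b c).det with hD
  have hDpos : 0 < D := Real.sqrt_pos.mpr hdpos
  have hDsq : D ^ 2 = (1 / a + 1 / b) * (1 / c + 1 / b) - (1 / b) ^ 2 := by
    rw [hD, Real.sq_sqrt hdpos.le, matA, Matrix.det_fin_two_of]
    ring
  have h := integral_exp_quadratic_mul_sign (P := 1 / a + 1 / b) (Q := 1 / c + 1 / b)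
    (R := 1 / b) (by positivity) (by positivity) hDpos hDsq
  have hR : 1 / b / D = √(a * c / (b * (a + b + c))) := by
    rw [eq_comm, Real.sqrt_eq_iff_mul_self_eq (by positivity) (by positivity), ← sq, div_pow, hD,
      Real.sq_sqrt hdpos.le, hdet]
    field_simp
  rw [← hR]
  have hG : G a b c = D / (2 * Real.pi) * (4 / D * Real.arctan (1 / b / D)) := by
    rw [← h, ← integral_const_mul, G]
    refine integral_congr_ae (Eventually.of_forall fun z => ?_)
    have hq : -(1 / 2) * (![z.1, z.2] ⬝ᵥ (matA a b c).mulVec ![z.1, z.2]) =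
        -((1 / a + 1 / b) * z.1 ^ 2 + (1 / c + 1 / b) * z.2 ^ 2 - 2 * (1 / b) * (z.1 * z.2)) / 2 := by
      simp [matA, Matrix.mulVec, dotProduct, Fin.sum_univ_two]
      ring
    simp only [density, hq]
    ring
  rw [hG]
  field_simp
  norm_num

/-! ### The mean over positions -/

section ArctanSqrt

variable {h s g : ℝ}

/-- An antiderivative of `arctan (√(h ^ 2 - x ^ 2) / s)` on `[-h, h]`, where
`g ^ 2 = h ^ 2 + s ^ 2`. -/
noncomputable def arctanSqrtPrimitive (h s g x : ℝ) : ℝ :=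
  x * Real.arctan (√(h ^ 2 - x ^ 2) / s) - s * Real.arcsin (x / h) +
    g * Real.arcsin (x * s / (h * √(g ^ 2 - x ^ 2)))

theorem hasDerivAt_sqrt_sq_sub_sq {r x : ℝ} (hx : 0 < r ^ 2 - x ^ 2) :
    HasDerivAt (fun x : ℝ => √(r ^ 2 - x ^ 2)) (-x / √(r ^ 2 - x ^ 2)) x := by
  have h1 : HasDerivAt (fun x : ℝ => r ^ 2 - x ^ 2) (-(2 * x)) x := by
    simpa using (hasDerivAt_pow 2 x).const_sub (r ^ 2)
  exact (h1.sqrt hx.ne').congr_deriv (by field_simp)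

theorem hasDerivAt_arctanSqrtPrimitive (hh : 0 < h) (hs : 0 < s) (hg : 0 < g)
    (hgs : g ^ 2 = h ^ 2 + s ^ 2) {x : ℝ} (hx : x ∈ Ioo (-h) h) :
    HasDerivAt (arctanSqrtPrimitive h s g) (Real.arctan (√(h ^ 2 - x ^ 2) / s)) x := by
  have hx2 : 0 < h ^ 2 - x ^ 2 := by nlinarith [hx.1, hx.2]
  have hX2 : 0 < g ^ 2 - x ^ 2 := by rw [hgs]; nlinarith [sq_pos_of_pos hs]
  have hw := hasDerivAt_sqrt_sq_sub_sq hx2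
  have hW := hasDerivAt_sqrt_sq_sub_sq hX2
  have hwpos : 0 < √(h ^ 2 - x ^ 2) := Real.sqrt_pos.mpr hx2
  have hWpos : 0 < √(g ^ 2 - x ^ 2) := Real.sqrt_pos.mpr hX2
  have hwsq : √(h ^ 2 - x ^ 2) ^ 2 = h ^ 2 - x ^ 2 := Real.sq_sqrt hx2.le
  have hWsq : √(g ^ 2 - x ^ 2) ^ 2 = g ^ 2 - x ^ 2 := Real.sq_sqrt hX2.le
  set w := √(h ^ 2 - x ^ 2) with hwdef
  set W := √(g ^ 2 - x ^ 2) with hWdef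
  -- These perfect squares remove the square roots from the arcsine derivatives; the second one
  -- relies on `g ^ 2 = h ^ 2 + s ^ 2`.
  have e2 : 1 - (x / h) ^ 2 = (w / h) ^ 2 := by
    rw [div_pow w, hwsq]
    field_simp
  have e3 : 1 - (x * s / (h * W)) ^ 2 = (g * w / (h * W)) ^ 2 := by
    rw [div_pow, div_pow, mul_pow g, mul_pow h, hwsq, hWsq]
    field_simp
    rw [hgs]
    ring
  have d1 := (hasDerivAt_id x).mul ((hw.div_const s).arctan)
  have hne2 : x / h ≠ -1 ∧ x / h ≠ 1 := by
    have hz : 0 < (w / h) ^ 2 := by positivity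
    constructor <;> intro hc <;> rw [← e2, hc] at hz <;> norm_num at hz
  have hz2 : 0 < (g * w / (h * W)) ^ 2 := by positivity
  have hne3 : x * s / (h * W) ≠ -1 ∧ x * s / (h * W) ≠ 1 := by
    constructor <;> intro hc <;> rw [← e3, hc] at hz2 <;> norm_num at hz2
  have d2 := ((Real.hasDerivAt_arcsin hne2.1 hne2.2).comp x ((hasDerivAt_id x).div_const h)).const_mul s
  have d3' := ((hasDerivAt_id x).mul_const s).div (hW.const_mul h) (by positivity)
  have d3 := ((Real.hasDerivAt_arcsin hne3.1 hne3.2).comp x d3').const_mul g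
  refine ((d1.sub d2).add d3).congr_deriv ?_
  rw [e2, e3, Real.sqrt_sq (by positivity), Real.sqrt_sq (by positivity)]
  simp only [id]
  rw [← hwdef, ← hWdef]
  have e1 : 1 + (w / s) ^ 2 = W ^ 2 / s ^ 2 := by
    rw [div_pow, hwsq, hWsq, hgs]
    field_simp
    ring
  rw [e1]
  field_simp
  rw [hWsq]
  ring

theorem continuousOn_arctanSqrtPrimitive (hh : 0 < h) (hs : 0 < s)
    (hgs : g ^ 2 = h ^ 2 + s ^ 2) :
    ContinuousOn (arctanSqrtPrimitive h s g) (Icc (-h) h) := by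
  have hpos : ∀ x ∈ Icc (-h) h, h * √(g ^ 2 - x ^ 2) ≠ 0 := by
    intro x hx
    have : 0 < g ^ 2 - x ^ 2 := by rw [hgs]; nlinarith [hx.1, hx.2, sq_pos_of_pos hs]
    have := Real.sqrt_pos.mpr this
    positivity
  unfold arctanSqrtPrimitive
  refine ContinuousOn.add (Continuous.continuousOn ?_) (ContinuousOn.mul continuousOn_const ?_)
  · refine Continuous.sub (continuous_id.mul (Real.continuous_arctan.comp (by fun_prop)))
      (continuous_const.mul (Real.continuous_arcsin.comp (by fun_prop)))
  · refine Real.continuous_arcsin.comp_continuousOn (ContinuousOn.div (by fun_prop) ?_ hpos)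
    exact Continuous.continuousOn (by fun_prop)

/-- At `±h` the arctangent term vanishes and both arcsines equal `±π / 2`. The derivative formula is
available only inside the interval, so continuity of the primitive is used at the ends. -/
theorem integral_arctan_sqrt (hh : 0 < h) (hs : 0 < s) (hg : 0 < g)
    (hgs : g ^ 2 = h ^ 2 + s ^ 2) :
    ∫ x in (-h)..h, Real.arctan (√(h ^ 2 - x ^ 2) / s) = Real.pi * (g - s) := by
  have hcont : Continuous fun x : ℝ => Real.arctan (√(h ^ 2 - x ^ 2) / s) :=
    Real.continuous_arctan.comp (by fun_prop)
  rw [intervalIntegral.integral_eq_sub_of_hasDerivAt_of_le (by linarith)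
    (continuousOn_arctanSqrtPrimitive hh hs hgs)
    (fun x hx => hasDerivAt_arctanSqrtPrimitive hh hs hg hgs hx) (hcont.intervalIntegrable _ _)]
  have e1 : √(g ^ 2 - h ^ 2) = s := by
    rw [hgs, add_sub_cancel_left, Real.sqrt_sq hs.le]
  have e2 : h * s / (h * s) = 1 := div_self (by positivity)
  simp only [arctanSqrtPrimitive, neg_sq, sub_self, Real.sqrt_zero, zero_div, Real.arctan_zero,
    mul_zero, e1, neg_mul, neg_div, e2, div_self hh.ne', Real.arcsin_one, Real.arcsin_neg]
  ring

end ArctanSqrt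

theorem Gobc_eq {b : ℝ} (hb0 : 0 < b) (hb1 : b < 1) : Gobc b = (1 - √b) / (1 + √b) := by
  have hs : 0 < √b := Real.sqrt_pos.mpr hb0
  have hsq : √b ^ 2 = b := Real.sq_sqrt hb0.le
  -- With `a + c = 1 - b`, centring `a` at `h = (1 - b) / 2` turns `a c` into `h ^ 2 - x ^ 2`; then
  -- `h ^ 2 + b = ((1 + b) / 2) ^ 2` gives `g`.
  have hI := integral_arctan_sqrt (h := (1 - b) / 2) (s := √b) (g := (1 + b) / 2) (by linarith) hs
    (by linarith) (by rw [hsq]; ring)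
  have hG : ∫ a in (0 : ℝ)..(1 - b), G a b (1 - a - b) =
      ∫ a in (0 : ℝ)..(1 - b), 2 / Real.pi *
        Real.arctan (√(((1 - b) / 2) ^ 2 - (a - (1 - b) / 2) ^ 2) / √b) := by
    rw [intervalIntegral.integral_of_le (by linarith), intervalIntegral.integral_of_le (by linarith),
      integral_Ioc_eq_integral_Ioo, integral_Ioc_eq_integral_Ioo]
    refine setIntegral_congr_fun measurableSet_Ioo fun a ha => ?_
    rw [G_eq ha.1 hb0 (by linarith [ha.2]), ← Real.sqrt_div']
    · congr 3
      rw [show a + b + (1 - a - b) = 1 by ring]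
      ring_nf
    · exact hb0.le
  have hsub := intervalIntegral.integral_comp_sub_right (a := 0) (b := 1 - b)
    (fun x : ℝ => Real.arctan (√(((1 - b) / 2) ^ 2 - x ^ 2) / √b)) ((1 - b) / 2)
  rw [show (0 : ℝ) - (1 - b) / 2 = -((1 - b) / 2) by ring,
    show 1 - b - (1 - b) / 2 = (1 - b) / 2 by ring, hI] at hsub
  rw [Gobc, hG, intervalIntegral.integral_const_mul, hsub]
  have h1b : 1 - b = (1 - √b) * (1 + √b) := by linear_combination hsq
  have hlt : √b < 1 := by nlinarith
  have hne : 1 - √b ≠ 0 := by linarith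
  have hπ := Real.pi_ne_zero
  have e : (1 + b) / 2 - √b = (1 - √b) ^ 2 / 2 := by
    rw [sub_sq, hsq]; ring
  rw [e, h1b]
  field_simp

/-! ### A common probability space and empirical fluctuations -/

/-- The law of a sequence of independent uniform points of `[0, 1]`. -/
noncomputable def samples : Measure (ℕ → I) := Measure.infinitePi fun _ => volume

instance : IsProbabilityMeasure samples := by unfold samples; infer_instance

/-- The first `L` sample points, rescaled to `[0, L]`. -/
def rescaledPoints (L : ℕ) (u : ℕ → I) (i : Fin L) : ℝ := L * (u i : ℝ)

theorem measurable_rescaledPoints (L : ℕ) : Measurable (rescaledPoints L) := by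
  unfold rescaledPoints
  fun_prop

theorem map_mul_volume_unitInterval {L : ℕ} (hL : 0 < L) :
    Measure.map (fun x : I => (L : ℝ) * x) volume =
      ProbabilityTheory.cond volume (Icc (0 : ℝ) L) := by
  have hL' : (0 : ℝ) < L := Nat.cast_pos.mpr hL
  have hpre : (fun x : ℝ => (L : ℝ) * x) ⁻¹' Icc (0 : ℝ) L = I := by
    ext x
    simp only [mem_preimage, mem_Icc]
    constructor
    · rintro ⟨h0, h1⟩
      exact ⟨nonneg_of_mul_nonneg_right h0 hL', le_of_mul_le_mul_left (by linarith) hL'⟩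
    · rintro ⟨h0, h1⟩
      exact ⟨by positivity, by nlinarith⟩
  have hcomp : (fun x : I => (L : ℝ) * x) = (fun x : ℝ => (L : ℝ) * x) ∘ Subtype.val := rfl
  rw [hcomp, ← Measure.map_map (by fun_prop) measurable_subtype_coe,
    unitInterval.measurePreserving_coe.map_eq, ← hpre,
    ← Measure.restrict_map (by fun_prop) measurableSet_Icc, Real.map_volume_mul_left hL'.ne',
    Measure.restrict_smul, ProbabilityTheory.cond, Real.volume_Icc, sub_zero, abs_inv,
    abs_of_pos hL', ENNReal.ofReal_inv_of_pos hL']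

theorem iIndepFun_samples : iIndepFun (fun (i : ℕ) (u : ℕ → I) => u i) samples :=
  iIndepFun_infinitePi (X := fun _ x => x) fun _ => measurable_id

theorem measurePreserving_eval_samples (i : ℕ) :
    MeasurePreserving (fun u : ℕ → I => u i) samples volume :=
  measurePreserving_eval_infinitePi _ i

theorem map_rescaledPoints (L : ℕ) : Measure.map (rescaledPoints L) samples = blueLaw L := by
  have hind : iIndepFun (fun (i : Fin L) (u : ℕ → I) => (L : ℝ) * (u i : ℝ)) samples :=
    (iIndepFun_samples.precomp (g := fun i : Fin L => (i : ℕ)) Fin.val_injective).comp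
      (fun _ (x : I) => (L : ℝ) * x) fun _ => by fun_prop
  have h := (iIndepFun_iff_map_fun_eq_pi_map fun i => Measurable.aemeasurable (by fun_prop)).mp hind
  refine h.trans ?_
  unfold blueLaw
  congr 1
  funext i
  rw [← map_mul_volume_unitInterval (Nat.zero_lt_of_lt i.2),
    ← (measurePreserving_eval_samples i).map_eq, Measure.map_map (by fun_prop) (by fun_prop)]
  rfl

/-- The normalised fluctuation of the sum of `g` over the first `L` sample points. -/
noncomputable def fluct (g : I → ℝ) (L : ℕ) (u : ℕ → I) : ℝ :=
  (√(L : ℝ))⁻¹ * (∑ k ∈ Finset.range L, g (u k) - L * ∫ x, g x)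

theorem measurable_fluct {g : I → ℝ} (hg : Measurable g) (L : ℕ) : Measurable (fluct g L) := by
  unfold fluct
  fun_prop

theorem fluct_sub {g g' : I → ℝ} (hg : Integrable g) (hg' : Integrable g') (L : ℕ)
    (u : ℕ → I) : fluct (fun x => g x - g' x) L u = fluct g L u - fluct g' L u := by
  simp only [fluct, Finset.sum_sub_distrib, integral_sub hg hg']
  ring

theorem fluct_sum {ι : Type*} [Fintype ι] {g : ι → I → ℝ} (hg : ∀ i, Integrable (g i))
    (v : ι → ℝ) (L : ℕ) (u : ℕ → I) :
    fluct (fun x => ∑ i, v i * g i x) L u = ∑ i, v i * fluct (g i) L u := by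
  simp only [fluct]
  rw [integral_finsetSum _ fun i _ => (hg i).const_mul (v i), Finset.sum_comm, Finset.mul_sum,
    ← Finset.sum_sub_distrib, Finset.mul_sum]
  refine Finset.sum_congr rfl fun i _ => ?_
  rw [integral_const_mul, ← Finset.mul_sum]
  ring

theorem identDistrib_samples {g : I → ℝ} (hg : Measurable g) (i j : ℕ) :
    IdentDistrib (fun u : ℕ → I => g (u i)) (fun u => g (u j)) samples samples where
  aemeasurable_fst := Measurable.aemeasurable (by fun_prop)
  aemeasurable_snd := Measurable.aemeasurable (by fun_prop)
  map_eq := by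
    change Measure.map (g ∘ fun u => u i) samples = Measure.map (g ∘ fun u => u j) samples
    rw [← Measure.map_map hg (by fun_prop), ← Measure.map_map hg (by fun_prop),
      (measurePreserving_eval_samples i).map_eq, (measurePreserving_eval_samples j).map_eq]

theorem integral_comp_eval_samples {g : I → ℝ} (hg : Measurable g) (i : ℕ) :
    ∫ u, g (u i) ∂samples = ∫ x, g x := by
  rw [← (measurePreserving_eval_samples i).map_eq,
    integral_map (measurable_pi_apply i).aemeasurable hg.aestronglyMeasurable]

theorem variance_comp_eval_samples {g : I → ℝ} (hg : Measurable g) (i : ℕ) :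
    Var[fun u => g (u i); samples] = Var[g; volume] := by
  rw [← (measurePreserving_eval_samples i).map_eq, variance_map hg.aemeasurable
    (measurable_pi_apply i).aemeasurable]
  rfl

theorem memLp_comp_eval_samples {g : I → ℝ} (hg : MemLp g 2) (i : ℕ) :
    MemLp (fun u : ℕ → I => g (u i)) 2 samples :=
  hg.comp_measurePreserving (measurePreserving_eval_samples i)

theorem iIndepFun_comp_samples {g : I → ℝ} (hg : Measurable g) :
    iIndepFun (fun (i : ℕ) (u : ℕ → I) => g (u i)) samples :=
  iIndepFun_samples.comp (fun _ => g) fun _ => hg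

theorem tendstoInDistribution_fluct {g : I → ℝ} (hg : Measurable g) (hg2 : MemLp g 2)
    {Ω : Type*} [MeasurableSpace Ω] {P : Measure Ω} [IsProbabilityMeasure P] {Y : Ω → ℝ}
    (hY : HasLaw Y (gaussianReal 0 Var[g; volume].toNNReal) P) :
    TendstoInDistribution (fluct g) atTop Y (fun _ => samples) P := by
  have h := tendstoInDistribution_inv_sqrt_mul_sum_sub (P := samples) (P' := P) (Y := Y)
    (X := fun k u => g (u k)) (by rwa [variance_comp_eval_samples hg])
    (memLp_comp_eval_samples hg2 0) (iIndepFun_comp_samples hg)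
    (fun i => identDistrib_samples hg i 0)
  rw [integral_comp_eval_samples hg] at h
  exact h

/-- Chebyshev's inequality, with a bound uniform in `L`. It serves twice: for tightness, and for
moving the threshold of an indicator. -/
theorem measure_le_abs_fluct_le {g : I → ℝ} (hg : Measurable g) (hg2 : MemLp g 2) (L : ℕ)
    {ε : ℝ} (hε : 0 < ε) :
    samples {u | ε ≤ |fluct g L u|} ≤ ENNReal.ofReal ((∫ x, g x ^ 2) / ε ^ 2) := by
  rcases Nat.eq_zero_or_pos L with rfl | hL
  · simp [fluct, hε.not_ge]
  have hL' : (0 : ℝ) < L := Nat.cast_pos.mpr hL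
  set S : (ℕ → I) → ℝ := ∑ k ∈ Finset.range L, fun u => g (u k) with hS
  have hSm : MemLp S 2 samples := memLp_finsetSum' _ fun k _ => memLp_comp_eval_samples hg2 k
  have hSvar : Var[S; samples] = L * Var[g; volume] := by
    rw [hS, IndepFun.variance_sum (fun k _ => memLp_comp_eval_samples hg2 k)
      fun i _ j _ hij => (iIndepFun_comp_samples hg).indepFun hij]
    simp [variance_comp_eval_samples hg]
  have hSint : ∫ u, S u ∂samples = L * ∫ x, g x := by
    simp only [hS, Finset.sum_apply]
    rw [integral_finsetSum _ fun k _ =>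
      (memLp_comp_eval_samples hg2 k).integrable one_le_two]
    simp [integral_comp_eval_samples hg]
  have hpos : 0 < √(L : ℝ) * ε := by positivity
  have hset : {u | ε ≤ |fluct g L u|} = {u | √(L : ℝ) * ε ≤ |S u - ∫ u, S u ∂samples|} := by
    ext u
    rw [hSint]
    simp only [mem_ofPred_eq, fluct, hS, Finset.sum_apply, abs_mul, abs_inv,
      abs_of_nonneg (Real.sqrt_nonneg (L : ℝ))]
    rw [← div_eq_inv_mul, le_div_iff₀ (by positivity), mul_comm]
  rw [hset]
  refine (meas_ge_le_variance_div_sq hSm hpos).trans (ENNReal.ofReal_le_ofReal ?_)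
  rw [hSvar, mul_pow, Real.sq_sqrt hL'.le, mul_div_mul_left _ _ hL'.ne']
  gcongr
  exact variance_le_expectation_sq hg.aestronglyMeasurable

/-! ### Indicators of intervals and their covariances -/

/-- The indicator of `[0, z]`. -/
noncomputable def below (z : ℝ) (x : I) : ℝ := if (x : ℝ) ≤ z then 1 else 0

theorem measurable_below (z : ℝ) : Measurable (below z) :=
  Measurable.ite (measurableSet_le (by fun_prop) measurable_const) measurable_const
    measurable_const

theorem memLp_below (z : ℝ) : MemLp (below z) 2 := by
  refine MemLp.of_bound (measurable_below z).aestronglyMeasurable 1 (Eventually.of_forall fun x => ?_)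
  unfold below
  split_ifs <;> simp

theorem integrable_below (z : ℝ) : Integrable (below z) :=
  (memLp_below z).integrable one_le_two

theorem integral_below (z : ℝ) : ∫ x, below z x = max 0 (min z 1) := by
  rcases lt_or_ge z 0 with hz | hz
  · have : below z = fun _ => 0 := by
      funext x
      simp [below, hz.trans_le x.2.1]
    rw [this]
    simp [min_le_of_left_le hz.le]
  rcases lt_or_ge 1 z with hz1 | hz1
  · have : below z = fun _ => 1 := by
      funext x
      simp [below, x.2.2.trans hz1.le]
    rw [this]
    simp [min_eq_right hz1.le]
  · have : below z = (Iic (⟨z, hz, hz1⟩ : I)).indicator fun _ => 1 := by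
      funext x
      simp [below, indicator_apply, ← Subtype.coe_le_coe]
    rw [this, integral_indicator_const _ measurableSet_Iic, min_eq_left hz1, max_eq_right hz]
    simp [measureReal_def, unitInterval.volume_Iic, hz]

theorem below_mul_below (s t : ℝ) (x : I) : below s x * below t x = below (min s t) x := by
  simp only [below, le_min_iff]
  split_ifs <;> simp_all

theorem integral_below_of_mem {t : ℝ} (ht : t ∈ Icc (0 : ℝ) 1) : ∫ x, below t x = t := by
  rw [integral_below, min_eq_left ht.2, max_eq_right ht.1]

theorem covariance_below {s t : ℝ} (hs : s ∈ Icc (0 : ℝ) 1) (ht : t ∈ Icc (0 : ℝ) 1) :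
    cov[below s, below t; volume] = min s t - s * t := by
  rw [covariance_eq_sub (memLp_below s) (memLp_below t), integral_below_of_mem hs,
    integral_below_of_mem ht]
  simp only [Pi.mul_apply, below_mul_below]
  rw [integral_below_of_mem ⟨le_min hs.1 ht.1, (min_le_left _ _).trans hs.2⟩]

/-- Clamping to `[0, 1]` is 1-Lipschitz. Values outside `[0, 1]` are needed because the thresholds
approaching `t` may overshoot the interval. -/
theorem integral_sq_below_sub_below_le (s t : ℝ) :
    ∫ x, (below s x - below t x) ^ 2 ≤ |s - t| := by
  have h : ∀ x, (below s x - below t x) ^ 2 = below s x + below t x - 2 * below (min s t) x := by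
    intro x
    have h1 : ∀ z, below z x * below z x = below z x := fun z => by rw [below_mul_below, min_self]
    rw [← below_mul_below]
    linear_combination h1 s + h1 t
  simp only [h]
  have hadd : Integrable fun x => below s x + below t x :=
    (integrable_below s).add (integrable_below t)
  rw [integral_sub hadd ((integrable_below _).const_mul 2), integral_add (integrable_below s) (integrable_below t),
    integral_const_mul, integral_below, integral_below, integral_below]
  rcases le_total s t with hst | hst
  · rw [min_eq_left hst, abs_of_nonpos (by linarith)]
    rcases max_cases 0 (min s 1) with h1 | h1 <;> rcases max_cases 0 (min t 1) with h2 | h2 <;>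
      rcases min_cases s 1 with h3 | h3 <;> rcases min_cases t 1 with h4 | h4 <;> linarith
  · rw [min_eq_right hst, abs_of_nonneg (by linarith)]
    rcases max_cases 0 (min s 1) with h1 | h1 <;> rcases max_cases 0 (min t 1) with h2 | h2 <;>
      rcases min_cases s 1 with h3 | h3 <;> rcases min_cases t 1 with h4 | h4 <;> linarith

/-! ### Joint central limit theorem for the empirical process -/

/-- A random vector with the joint law of the standard Brownian bridge at the times `t j`: all its
linear combinations are centred Gaussian with the variance of the bridge. -/
structure IsBridgeVector {k : ℕ} (t : Fin k → ℝ) {Ω : Type*} [MeasurableSpace Ω]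
    (Y : Ω → Fin k → ℝ) (P : Measure Ω) : Prop where
  aemeasurable : AEMeasurable Y P
  map_sum : ∀ v : Fin k → ℝ, P.map (fun ω => ∑ j, v j * Y ω j) =
    gaussianReal 0 (∑ i, ∑ j, v i * v j * (min (t i) (t j) - t i * t j)).toNNReal

theorem variance_sum_below {k : ℕ} {t : Fin k → ℝ} (ht : ∀ j, t j ∈ Icc (0 : ℝ) 1)
    (v : Fin k → ℝ) : Var[fun x => ∑ j, v j * below (t j) x; volume] =
      ∑ i, ∑ j, v i * v j * (min (t i) (t j) - t i * t j) := by
  rw [variance_fun_sum' fun j _ => (memLp_below (t j)).const_mul (v j)]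
  refine Finset.sum_congr rfl fun i _ => Finset.sum_congr rfl fun j _ => ?_
  rw [covariance_const_mul_left, covariance_const_mul_right, covariance_below (ht i) (ht j)]
  ring

theorem charFun_map_toLp {k : ℕ} {Ω : Type*} [MeasurableSpace Ω] {P : Measure Ω}
    {Z : Ω → Fin k → ℝ} (hZ : AEMeasurable Z P) (v : EuclideanSpace ℝ (Fin k)) :
    charFun (P.map (WithLp.toLp 2 ∘ Z)) v = charFun (P.map fun ω => ∑ j, v j * Z ω j) 1 := by
  have hm : Measurable (WithLp.toLp 2 : (Fin k → ℝ) → EuclideanSpace ℝ (Fin k)) := by fun_prop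
  rw [charFun_apply, charFun_apply, integral_map (hm.comp_aemeasurable hZ)
    (Continuous.aestronglyMeasurable (by fun_prop)), integral_map (by fun_prop)
    (Continuous.aestronglyMeasurable (by fun_prop))]
  simp [PiLp.inner_apply, mul_comm]

/-- Cramér-Wold device: the characteristic function of the vector at `v` is that of the combination
with coefficients `v` at `1`. The detour through `EuclideanSpace` supplies the inner product. -/
theorem tendstoInDistribution_of_forall_sum {k : ℕ} {Ω Ω' : Type*} [MeasurableSpace Ω]
    [MeasurableSpace Ω'] {P : Measure Ω} [IsProbabilityMeasure P] {P' : Measure Ω'}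
    [IsProbabilityMeasure P'] {X : ℕ → Ω → Fin k → ℝ} {Y : Ω' → Fin k → ℝ}
    (hX : ∀ n, AEMeasurable (X n) P) (hY : AEMeasurable Y P')
    (h : ∀ v : Fin k → ℝ, TendstoInDistribution (fun n ω => ∑ j, v j * X n ω j) atTop
      (fun ω => ∑ j, v j * Y ω j) (fun _ => P) P') :
    TendstoInDistribution X atTop Y (fun _ => P) P' := by
  have hm : Measurable (WithLp.toLp 2 : (Fin k → ℝ) → EuclideanSpace ℝ (Fin k)) := by fun_prop
  have hX' := fun n => hm.comp_aemeasurable (hX n)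
  have hY' := hm.comp_aemeasurable hY
  have key : TendstoInDistribution (fun n => WithLp.toLp 2 ∘ X n) atTop (WithLp.toLp 2 ∘ Y)
      (fun _ => P) P' := by
    refine ⟨hX', hY', ProbabilityMeasure.tendsto_iff_tendsto_charFun.mpr fun v => ?_⟩
    have h1 := ProbabilityMeasure.tendsto_iff_tendsto_charFun.mp (h v).tendsto 1
    simp only [ProbabilityMeasure.coe_mk] at h1 ⊢
    rw [charFun_map_toLp hY]
    exact h1.congr fun n => (charFun_map_toLp (hX n) v).symm
  exact key.continuous_comp (g := (WithLp.ofLp : EuclideanSpace ℝ (Fin k) → Fin k → ℝ))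
    (by fun_prop)

theorem tendstoInDistribution_neg_fluct_below {k : ℕ} {t : Fin k → ℝ}
    (ht : ∀ j, t j ∈ Icc (0 : ℝ) 1) {Ω : Type*} [MeasurableSpace Ω] {P : Measure Ω}
    [IsProbabilityMeasure P] {Y : Ω → Fin k → ℝ} (hY : IsBridgeVector t Y P) :
    TendstoInDistribution (fun L u j => -fluct (below (t j)) L u) atTop Y
      (fun _ => samples) P := by
  have hmeas : ∀ z L, Measurable (fluct (below z) L) := fun z => measurable_fluct (measurable_below z)
  have hYm := hY.aemeasurable
  refine tendstoInDistribution_of_forall_sum (fun L => by fun_prop) hYm fun v => ?_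
  have hfl : (fun L u => ∑ j, v j * -fluct (below (t j)) L u) =
      fluct (fun x => ∑ j, (-v) j * below (t j) x) := by
    funext L u
    rw [fluct_sum fun j => integrable_below (t j)]
    simp
  -- The minus sign has moved into the coefficients, where the quadratic variance does not see it.
  rw [hfl]
  refine tendstoInDistribution_fluct
    (Finset.measurable_sum _ fun j _ => (measurable_below (t j)).const_mul _)
    (memLp_finsetSum _ fun j _ => (memLp_below (t j)).const_mul _) ⟨by fun_prop, ?_⟩
  rw [hY.map_sum, variance_sum_below ht]
  simp

/-! ### Comparison of quantile and empirical processes -/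

/-- By tightness `V` lies in a bounded interval up to small probability. Cut that interval into
finitely many cells: if `U` and `V` are far apart, they are separated by a gap at an endpoint of the
cell of `V`. -/
theorem tendstoInMeasure_sub_of_tendsto_measure_crossing {Ω : Type*} [MeasurableSpace Ω]
    {P : Measure Ω} {U V : ℕ → Ω → ℝ}
    (htight : ∀ δ : ENNReal, 0 < δ → ∃ M : ℝ, ∀ n, P {ω | M ≤ |V n ω|} ≤ δ)
    (h1 : ∀ y ε : ℝ, 0 < ε → Tendsto (fun n => P {ω | V n ω ≤ y ∧ y + ε < U n ω}) atTop (𝓝 0))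
    (h2 : ∀ y ε : ℝ, 0 < ε → Tendsto (fun n => P {ω | y ≤ V n ω ∧ U n ω < y - ε}) atTop (𝓝 0)) :
    TendstoInMeasure P (fun n ω => U n ω - V n ω) atTop fun _ => 0 := by
  rw [tendstoInMeasure_iff_norm]
  intro ε hε
  simp only [sub_zero, Real.norm_eq_abs]
  rw [ENNReal.tendsto_nhds_zero]
  intro δ hδ
  obtain ⟨M, hM⟩ := htight (δ / 2) (ENNReal.half_pos hδ.ne')
  -- One `η` pays for the cell width, one for the gap, and the third makes the inequality strict.
  set η := ε / 3 with hη
  have hηpos : 0 < η := by positivity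
  set y : ℕ → ℝ := fun k => -M + k * η with hy
  set m := ⌈2 * M / η⌉₊ with hm
  set bad : ℕ → ENNReal := fun n => ∑ k ∈ Finset.range (m + 1),
    (P {ω | V n ω ≤ y (k + 1) ∧ y (k + 1) + η < U n ω} +
      P {ω | y k ≤ V n ω ∧ U n ω < y k - η}) with hbad
  have hbadlim : Tendsto bad atTop (𝓝 0) := by
    have : Tendsto bad atTop (𝓝 (∑ k ∈ Finset.range (m + 1), (0 + 0))) :=
      tendsto_finsetSum _ fun k _ => (h1 _ η hηpos).add (h2 _ η hηpos)
    simpa using this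
  filter_upwards [ENNReal.tendsto_nhds_zero.mp hbadlim (δ / 2) (ENNReal.half_pos hδ.ne')]
    with n hn
  have hsub : {ω | ε ≤ |U n ω - V n ω|} ⊆ {ω | M ≤ |V n ω|} ∪
      ⋃ k ∈ Finset.range (m + 1), ({ω | V n ω ≤ y (k + 1) ∧ y (k + 1) + η < U n ω} ∪
        {ω | y k ≤ V n ω ∧ U n ω < y k - η}) := by
    intro ω hω
    rcases le_or_gt M |V n ω| with hV | hV
    · exact Or.inl hV
    right
    have hV' := abs_lt.mp hV
    have hnn : 0 ≤ (V n ω + M) / η := div_nonneg (by linarith) hηpos.le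
    set k := ⌊(V n ω + M) / η⌋₊ with hk
    have hk1 : k * η ≤ V n ω + M := (le_div_iff₀ hηpos).mp (Nat.floor_le hnn)
    have hk2 : V n ω + M < (k + 1) * η := (div_lt_iff₀ hηpos).mp (Nat.lt_floor_add_one _)
    have hkm : k ≤ m := by
      have h3 : (V n ω + M) / η ≤ 2 * M / η := by gcongr; linarith
      exact (Nat.floor_mono h3).trans (Nat.floor_le_ceil _)
    refine mem_biUnion (x := k) (by simpa using Nat.lt_succ_of_le hkm) ?_
    simp only [hy]
    push_cast
    rcases le_abs'.mp (show ε ≤ |U n ω - V n ω| from hω) with h | h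
    · right
      constructor <;> linarith
    · left
      constructor <;> linarith
  calc P {ω | ε ≤ |U n ω - V n ω|} ≤ P {ω | M ≤ |V n ω|} + bad n := by
        refine (measure_mono hsub).trans ((measure_union_le _ _).trans ?_)
        gcongr
        refine (measure_biUnion_finset_le _ _).trans (Finset.sum_le_sum fun k _ => ?_)
        exact measure_union_le _ _
    _ ≤ δ / 2 + δ / 2 := add_le_add (hM n) hn
    _ = δ := ENNReal.add_halves δ

theorem orderStat_rescaledPoints_le_iff {L i : ℕ} (hi : i < L) (u : ℕ → I) (x : ℝ) :
    orderStat (rescaledPoints L u) ⟨i, hi⟩ ≤ x ↔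
      (i : ℝ) < ∑ k ∈ Finset.range L, below (x / L) (u k) := by
  have hL : (0 : ℝ) < L := Nat.cast_pos.mpr (Nat.zero_lt_of_lt hi)
  rw [orderStat_le_iff, ← Nat.cast_lt (α := ℝ), Finset.card_filter, ← Fin.sum_univ_eq_sum_range
    fun k => below (x / L) (u k)]
  push_cast
  simp only [below, rescaledPoints, le_div_iff₀' hL]
  congr!

/-- The rescaled displacement of the order statistic of index `i L`, shifted by `κ`. -/
noncomputable def quantileFluct (i : ℕ → ℕ) (κ : ℝ) (L : ℕ) (b : Fin L → ℝ) : ℝ :=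
  if h : i L < L then (orderStat b ⟨i L, h⟩ - i L - κ) / √(L : ℝ) else 0

theorem measurable_quantileFluct (i : ℕ → ℕ) (κ : ℝ) (L : ℕ) :
    Measurable (quantileFluct i κ L) := by
  unfold quantileFluct
  split_ifs with h
  · have := measurable_orderStat (L := L) ⟨i L, h⟩
    fun_prop
  · exact measurable_const

section Coupling

variable {i : ℕ → ℕ} {t : ℝ}

theorem tendsto_threshold_div (hlim : Tendsto (fun L => (i L : ℝ) / L) atTop (𝓝 t)) (κ y : ℝ) :
    Tendsto (fun L : ℕ => (i L + κ + √(L : ℝ) * y) / L) atTop (𝓝 t) := by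
  have h1 : Tendsto (fun L : ℕ => κ / (L : ℝ)) atTop (𝓝 0) :=
    tendsto_const_div_atTop_nhds_zero_nat κ
  have h2 : Tendsto (fun L : ℕ => y / √(L : ℝ)) atTop (𝓝 0) :=
    (Real.tendsto_sqrt_atTop.comp tendsto_natCast_atTop_atTop).const_div_atTop y
  have h := (hlim.add h1).add h2
  rw [add_zero, add_zero] at h
  refine h.congr fun L => ?_
  rw [add_div, add_div, mul_comm, mul_div_assoc y, Real.sqrt_div_self', mul_one_div]

theorem tendsto_measure_fluct_below_sub {x : ℕ → ℝ} (hx : Tendsto x atTop (𝓝 t)) {ε : ℝ}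
    (hε : 0 < ε) :
    Tendsto (fun L => samples {u | ε ≤ |fluct (below (x L)) L u - fluct (below t) L u|})
      atTop (𝓝 0) := by
  have hbound : ∀ L, samples {u | ε ≤ |fluct (below (x L)) L u - fluct (below t) L u|} ≤
      ENNReal.ofReal (|x L - t| / ε ^ 2) := by
    intro L
    simp only [← fluct_sub (integrable_below _) (integrable_below _)]
    refine (measure_le_abs_fluct_le ((measurable_below _).sub (measurable_below _))
      ((memLp_below _).sub (memLp_below _)) L hε).trans (ENNReal.ofReal_le_ofReal ?_)
    gcongr
    exact integral_sq_below_sub_below_le _ _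
  refine tendsto_of_tendsto_of_tendsto_of_le_of_le tendsto_const_nhds ?_ (fun _ => zero_le)
    hbound
  have h := ((hx.sub_const t).abs.div_const (ε ^ 2))
  simpa [Function.comp_def] using (ENNReal.continuous_ofReal.tendsto _).comp h

theorem exists_forall_measure_le_abs_fluct_le {g : I → ℝ} (hg : Measurable g) (hg2 : MemLp g 2)
    {δ : ENNReal} (hδ : 0 < δ) : ∃ M : ℝ, ∀ L, samples {u | M ≤ |fluct g L u|} ≤ δ := by
  have h : Tendsto (fun M : ℝ => ENNReal.ofReal ((∫ x, g x ^ 2) / M ^ 2)) atTop (𝓝 0) := by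
    have h1 : Tendsto (fun M : ℝ => (∫ x, g x ^ 2) / M ^ 2) atTop (𝓝 0) :=
      (tendsto_pow_atTop two_ne_zero).const_div_atTop _
    simpa [Function.comp_def] using (ENNReal.continuous_ofReal.tendsto _).comp h1
  obtain ⟨M, hM, hpos⟩ := ((ENNReal.tendsto_nhds_zero.mp h δ hδ).and (eventually_gt_atTop 0)).exists
  exact ⟨M, fun L => (measure_le_abs_fluct_le hg hg2 L hpos).trans hM⟩

theorem eventually_abs_div_sqrt_lt (κ : ℝ) {ε : ℝ} (hε : 0 < ε) :
    ∀ᶠ L : ℕ in atTop, |κ / √(L : ℝ)| < ε := by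
  have h : Tendsto (fun L : ℕ => |κ / √(L : ℝ)|) atTop (𝓝 |0|) :=
    ((Real.tendsto_sqrt_atTop.comp tendsto_natCast_atTop_atTop).const_div_atTop κ).abs
  rw [abs_zero] at h
  exact h.eventually_lt_const hε

theorem sum_below_eq_of_one_le {L : ℕ} {z : ℝ} (hz : 1 ≤ z) (u : ℕ → I) :
    ∑ k ∈ Finset.range L, below z (u k) = L := by
  simp [below, (u _).2.2.trans hz]

theorem sum_below_eq_of_neg {L : ℕ} {z : ℝ} (hz : z < 0) (u : ℕ → I) :
    ∑ k ∈ Finset.range L, below z (u k) = 0 := by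
  simp [below, hz.trans_le (u _).2.1]

theorem fluct_below_le_of_lt_quantileFluct {L : ℕ} (hi : i L < L) {κ y : ℝ} {u : ℕ → I}
    (h : y < quantileFluct i κ L (rescaledPoints L u)) :
    fluct (below ((i L + κ + √(L : ℝ) * y) / L)) L u ≤ -y - κ / √(L : ℝ) := by
  have hL : (0 : ℝ) < L := Nat.cast_pos.mpr (Nat.zero_lt_of_lt hi)
  have hs : 0 < √(L : ℝ) := Real.sqrt_pos.mpr hL
  have hiL : (i L : ℝ) < L := Nat.cast_lt.mpr hi
  set x := i L + κ + √(L : ℝ) * y with hx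
  rw [quantileFluct, dif_pos hi, lt_div_iff₀ hs] at h
  have hlt : ¬ orderStat (rescaledPoints L u) ⟨i L, hi⟩ ≤ x := by
    rw [not_le, hx]
    linarith
  rw [orderStat_rescaledPoints_le_iff, not_lt] at hlt
  -- Beyond `1` the count would be `L`, more than `i L`. Below `1` the clamping in `integral_below`
  -- can only raise the mean, which is the favourable direction.
  have hxL : x / L < 1 := by
    by_contra! hc
    rw [sum_below_eq_of_one_le hc] at hlt
    linarith
  have hint : x ≤ L * ∫ z, below (x / L) z := by
    rw [integral_below, min_eq_left hxL.le]
    calc x = L * (x / L) := by field_simp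
      _ ≤ _ := by gcongr; exact le_max_right _ _
  have he : -y - κ / √(L : ℝ) = (√(L : ℝ))⁻¹ * (i L - x) := by
    rw [hx]
    field_simp
    ring
  rw [he, fluct]
  gcongr

theorem le_fluct_below_of_quantileFluct_le {L : ℕ} (hi : i L < L) {κ y : ℝ} {u : ℕ → I}
    (h : quantileFluct i κ L (rescaledPoints L u) ≤ y) :
    -y - κ / √(L : ℝ) ≤ fluct (below ((i L + κ + √(L : ℝ) * y) / L)) L u := by
  have hL : (0 : ℝ) < L := Nat.cast_pos.mpr (Nat.zero_lt_of_lt hi)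
  have hs : 0 < √(L : ℝ) := Real.sqrt_pos.mpr hL
  set x := i L + κ + √(L : ℝ) * y with hx
  rw [quantileFluct, dif_pos hi, div_le_iff₀ hs] at h
  have hle : orderStat (rescaledPoints L u) ⟨i L, hi⟩ ≤ x := by
    rw [hx]
    linarith
  rw [orderStat_rescaledPoints_le_iff] at hle
  have hx0 : 0 ≤ x / L := by
    by_contra! hc
    rw [sum_below_eq_of_neg hc] at hle
    exact hle.not_ge (Nat.cast_nonneg _)
  have hint : L * ∫ z, below (x / L) z ≤ x := by
    rw [integral_below]
    calc L * max 0 (min (x / L) 1) ≤ L * (x / L) := by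
          gcongr
          exact max_le hx0 (min_le_left _ _)
      _ = x := by field_simp
  have he : -y - κ / √(L : ℝ) = (√(L : ℝ))⁻¹ * (i L - x) := by
    rw [hx]
    field_simp
    ring
  rw [he, fluct]
  gcongr

/-- The quantile process is asymptotically minus the empirical process. -/
theorem tendstoInMeasure_quantileFluct_add_fluct (hi : ∀ᶠ L in atTop, i L < L)
    (hlim : Tendsto (fun L => (i L : ℝ) / L) atTop (𝓝 t)) (κ : ℝ) :
    TendstoInMeasure samples
      (fun L u => quantileFluct i κ L (rescaledPoints L u) - -fluct (below t) L u)
      atTop fun _ => 0 := by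
  refine tendstoInMeasure_sub_of_tendsto_measure_crossing ?_ ?_ ?_
  · intro δ hδ
    simp only [abs_neg]
    exact exists_forall_measure_le_abs_fluct_le (measurable_below t) (memLp_below t) hδ
  -- On the crossing event the fluctuations at `t` and at a threshold tending to `t` differ by at
  -- least `ε / 2`, once `κ / √L` is below `ε / 2`.
  · intro y ε hε
    refine tendsto_of_tendsto_of_tendsto_of_le_of_le' tendsto_const_nhds
      (tendsto_measure_fluct_below_sub (tendsto_threshold_div hlim κ (y + ε)) (half_pos hε))
      (Eventually.of_forall fun _ => zero_le) ?_
    filter_upwards [hi, eventually_abs_div_sqrt_lt κ (half_pos hε)] with L hiL hκ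
    refine measure_mono fun u hu => ?_
    have h1 := fluct_below_le_of_lt_quantileFluct hiL hu.2
    have h2 := (abs_lt.mp hκ).1
    have h3 : -fluct (below t) L u ≤ y := hu.1
    rw [mem_ofPred_eq, le_abs]
    right
    linarith
  · intro y ε hε
    refine tendsto_of_tendsto_of_tendsto_of_le_of_le' tendsto_const_nhds
      (tendsto_measure_fluct_below_sub (tendsto_threshold_div hlim κ (y - ε)) (half_pos hε))
      (Eventually.of_forall fun _ => zero_le) ?_
    filter_upwards [hi, eventually_abs_div_sqrt_lt κ (half_pos hε)] with L hiL hκ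
    refine measure_mono fun u hu => ?_
    have h1 := le_fluct_below_of_quantileFluct_le hiL hu.2.le
    have h2 := (abs_lt.mp hκ).2
    have h3 : y ≤ -fluct (below t) L u := hu.1
    rw [mem_ofPred_eq, le_abs]
    left
    linarith

end Coupling

/-! ### Joint limit of the displacements -/

section JointLimit

variable {k : ℕ} {t : Fin k → ℝ} {i : Fin k → ℕ → ℕ} {Ω : Type*} [MeasurableSpace Ω]
  {P : Measure Ω} [IsProbabilityMeasure P] {Y : Ω → Fin k → ℝ}

theorem tendstoInMeasure_pi {Ω : Type*} [MeasurableSpace Ω] {P : Measure Ω}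
    {X : ℕ → Ω → Fin k → ℝ}
    (h : ∀ j, TendstoInMeasure P (fun n ω => X n ω j) atTop fun _ => 0) :
    TendstoInMeasure P X atTop 0 := by
  rw [tendstoInMeasure_iff_norm]
  intro ε hε
  have hlim : Tendsto (fun n => ∑ j, P {ω | ε ≤ ‖X n ω j - 0‖}) atTop (𝓝 (∑ _j : Fin k, 0)) :=
    tendsto_finsetSum _ fun j _ => (tendstoInMeasure_iff_norm.mp (h j)) ε hε
  rw [Finset.sum_const_zero] at hlim
  refine tendsto_of_tendsto_of_tendsto_of_le_of_le tendsto_const_nhds hlim (fun _ => zero_le)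
    fun n => ?_
  have hsub : {ω | ε ≤ ‖X n ω - (0 : Ω → Fin k → ℝ) ω‖} ⊆
      ⋃ j ∈ Finset.univ, {ω | ε ≤ ‖X n ω j - 0‖} := by
    intro ω hω
    by_contra hc
    simp only [Finset.mem_univ, iUnion_true, mem_iUnion, mem_ofPred_eq, not_exists, not_le] at hc
    exact hω.not_gt ((pi_norm_lt_iff hε).mpr fun j => by simpa using hc j)
  exact (measure_mono hsub).trans (measure_biUnion_finset_le _ _)

/-- The spaces carrying `blueLaw L` vary with `L`, so the comparison in measure is made on `samples`
and only the resulting laws are transferred. -/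
theorem tendstoInDistribution_quantileFluct (ht : ∀ j, t j ∈ Icc (0 : ℝ) 1)
    (hi : ∀ j, ∀ᶠ L in atTop, i j L < L)
    (hlim : ∀ j, Tendsto (fun L => (i j L : ℝ) / L) atTop (𝓝 (t j))) (κ : ℝ)
    (hY : IsBridgeVector t Y P) :
    TendstoInDistribution (fun L b j => quantileFluct (i j) κ L b) atTop Y blueLaw P := by
  have hm : ∀ L, Measurable fun (b : Fin L → ℝ) (j : Fin k) => quantileFluct (i j) κ L b :=
    fun L => measurable_pi_lambda _ fun j => measurable_quantileFluct (i j) κ L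
  have hs := tendstoInDistribution_of_tendstoInMeasure_sub
    (fun L u j => quantileFluct (i j) κ L (rescaledPoints L u)) Y
    (tendstoInDistribution_neg_fluct_below ht hY)
    (tendstoInMeasure_pi fun j => tendstoInMeasure_quantileFluct_add_fluct (hi j) (hlim j) κ)
    fun L => ((hm L).comp (measurable_rescaledPoints L)).aemeasurable
  refine ⟨fun L => (hm L).aemeasurable, hY.aemeasurable, hs.tendsto.congr fun L => ?_⟩
  apply Subtype.ext
  simp only
  rw [← map_rescaledPoints, Measure.map_map (hm L) (measurable_rescaledPoints L)]
  rfl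

/-- A constant shift disappears after division by `√L`: `κ = 1 / 2` serves the rescaled process and
`κ = 0` the spins. The chosen optimal matching need only agree almost surely with the measurable
order statistics. -/
theorem tendstoInDistribution_displacement {p : ℝ} (hp : 1 < p)
    (ht : ∀ j, t j ∈ Icc (0 : ℝ) 1) (hi : ∀ j, ∀ᶠ L in atTop, i j L < L)
    (hlim : ∀ j, Tendsto (fun L => (i j L : ℝ) / L) atTop (𝓝 (t j))) (κ : ℝ)
    (hY : IsBridgeVector t Y P) :
    TendstoInDistribution (fun (L : ℕ) (b : Fin L → ℝ) (j : Fin k) =>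
      if h : i j L < L then (displacement p b ⟨i j L, h⟩ - κ) / √(L : ℝ) else 0)
      atTop Y blueLaw P := by
  refine (tendstoInDistribution_quantileFluct ht hi hlim (1 / 2 + κ) hY).congr (fun L => ?_)
    (EventuallyEq.refl _ _)
  filter_upwards [ae_injective_blueLaw L] with b hb
  funext j
  unfold quantileFluct
  split_ifs with h
  · rw [displacement_eq_orderStat_sub hp hb, red]
    congr 1
    simp only
    ring
  · rfl

end JointLimit

theorem IsBrownianBridge.isBridgeVector {Ω : Type*} [MeasurableSpace Ω] {P : Measure Ω}
    {B : I → Ω → ℝ} (hB : IsBrownianBridge B P) {k : ℕ} (t : Fin k → I) :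
    IsBridgeVector (fun j => (t j : ℝ)) (fun ω j => B (t j) ω) P where
  aemeasurable := aemeasurable_pi_lambda _ fun j => hB.isGaussianProcess.aemeasurable (t j)
  map_sum v := by
    have hprob := hB.isGaussianProcess.isProbabilityMeasure
    have hlaw : HasGaussianLaw (fun ω => ∑ j, v j * B (t j) ω) P :=
      ((hB.isGaussianProcess.comp_right t).smul v).hasGaussianLaw_fun_sum
    have hmem : ∀ j, MemLp (B (t j)) 2 P := fun j =>
      (hB.isGaussianProcess.hasGaussianLaw_eval (t j)).memLp_two
    rw [hlaw.map_eq_gaussianReal]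
    congr 2
    · rw [integral_finsetSum _ fun j _ => ((hmem j).integrable one_le_two).const_mul (v j)]
      simp [integral_const_mul, hB.integral_eq_zero]
    · rw [variance_fun_sum' fun j _ => (hmem j).const_mul (v j)]
      refine Finset.sum_congr rfl fun i _ => Finset.sum_congr rfl fun j _ => ?_
      rw [covariance_const_mul_left, covariance_const_mul_right, hB.covariance_eq]
      ring

/-! ### Sign correlation of a bridge pair -/

/-- The law of two independent standard Gaussian variables. -/
noncomputable def gaussianPair : Measure (ℝ × ℝ) := (gaussianReal 0 1).prod (gaussianReal 0 1)

instance : IsProbabilityMeasure gaussianPair := by unfold gaussianPair; infer_instance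

theorem sign_mul_of_pos {c : ℝ} (hc : 0 < c) (x : ℝ) : Real.sign (c * x) = Real.sign x := by
  rcases lt_trichotomy x 0 with hx | rfl | hx
  · rw [Real.sign_of_neg hx, Real.sign_of_neg (mul_neg_of_pos_of_neg hc hx)]
  · simp
  · rw [Real.sign_of_pos hx, Real.sign_of_pos (mul_pos hc hx)]

/-- Only `κ = β / γ` affects the sign. The shear `y ↦ y + κ x` preserves Lebesgue measure and leads
to a quadratic form of determinant `1`. -/
theorem integral_sign_gaussianPair {α β γ : ℝ} (hα : 0 < α) (hγ : 0 < γ) :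
    ∫ z, Real.sign (α * z.1 * (β * z.1 + γ * z.2)) ∂gaussianPair =
      2 / Real.pi * Real.arctan (β / γ) := by
  set κ := β / γ with hκ
  have hsign : ∀ x y : ℝ, Real.sign (α * x * (β * x + γ * y)) = Real.sign (x * (y + κ * x)) := by
    intro x y
    rw [← sign_mul_of_pos (mul_pos hα hγ) (x * (y + κ * x)), hκ]
    congr 1
    field_simp
    ring
  simp only [hsign]
  have hint : Integrable (fun z : ℝ × ℝ => Real.sign (z.1 * (z.2 + κ * z.1))) gaussianPair :=
    Integrable.of_bound (measurable_sign.comp (by fun_prop)).aestronglyMeasurable 1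
      (Eventually.of_forall fun z => abs_sign_le_one _)
  unfold gaussianPair at hint ⊢
  rw [integral_prod _ hint]
  simp only [integral_gaussianReal_eq_integral_smul one_ne_zero, smul_eq_mul]
  have h := integral_integral_exp_quadratic_mul_sign (P := 1 + κ ^ 2) (Q := 1) (R := κ) (D := 1)
    one_pos one_pos (by ring)
  rw [div_one, div_one] at h
  have hinner : ∀ x : ℝ, gaussianPDFReal 0 1 x *
      ∫ y : ℝ, gaussianPDFReal 0 1 y * Real.sign (x * (y + κ * x)) =
      1 / (2 * Real.pi) * ∫ y : ℝ, Real.exp (-((1 + κ ^ 2) * x ^ 2 + 1 * y ^ 2 - 2 * κ * (x * y)) / 2) *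
        Real.sign (x * y) := by
    intro x
    rw [← integral_const_mul, ← integral_const_mul, ← integral_add_right_eq_self (fun y : ℝ =>
      1 / (2 * Real.pi) * (Real.exp (-((1 + κ ^ 2) * x ^ 2 + 1 * y ^ 2 - 2 * κ * (x * y)) / 2) *
        Real.sign (x * y))) (κ * x)]
    refine integral_congr_ae (Eventually.of_forall fun y => ?_)
    simp only [gaussianPDFReal, NNReal.coe_one, mul_one, sub_zero]
    have h2π : (√(2 * Real.pi))⁻¹ * (√(2 * Real.pi))⁻¹ = 1 / (2 * Real.pi) := by
      rw [← mul_inv, Real.mul_self_sqrt (by positivity), one_div]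
    rw [← h2π, show -((1 + κ ^ 2) * x ^ 2 + 1 * (y + κ * x) ^ 2 - 2 * κ * (x * (y + κ * x))) / 2 =
      -x ^ 2 / 2 + -y ^ 2 / 2 by ring, Real.exp_add]
    ring
  simp only [hinner]
  rw [integral_const_mul, h]
  ring

theorem map_linear_gaussianPair (c d : ℝ) :
    gaussianPair.map (fun z => c * z.1 + d * z.2) =
      gaussianReal 0 (c ^ 2 + d ^ 2).toNNReal := by
  have h1 : HasLaw (fun z : ℝ × ℝ => z.1) (gaussianReal 0 1) gaussianPair :=
    ⟨by fun_prop, by unfold gaussianPair; exact measurePreserving_fst.map_eq⟩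
  have h2 : HasLaw (fun z : ℝ × ℝ => z.2) (gaussianReal 0 1) gaussianPair :=
    ⟨by fun_prop, by unfold gaussianPair; exact measurePreserving_snd.map_eq⟩
  have hind : IndepFun (fun z : ℝ × ℝ => c * z.1) (fun z => d * z.2) gaussianPair :=
    indepFun_prod (X := fun x => c * x) (Y := fun y => d * y) (by fun_prop) (by fun_prop)
  have h := gaussianReal_add_gaussianReal_of_indepFun hind (gaussianReal_const_mul h1 c).map_eq
    (gaussianReal_const_mul h2 d).map_eq
  refine h.trans ?_
  congr 1
  · simp
  · apply NNReal.eq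
    rw [Real.coe_toNNReal _ (by positivity)]
    simp

theorem exists_isBridgeVector_pair {s t : ℝ} (hs : 0 < s) (hst : s < t) (ht : t < 1) :
    ∃ Y : ℝ × ℝ → Fin 2 → ℝ, IsBridgeVector ![s, t] Y gaussianPair ∧
      ∫ z, Real.sign (Y z 0 * Y z 1) ∂gaussianPair = G s (t - s) (1 - t) := by
  have h1s : 0 < 1 - s := by linarith
  have h1t : 0 < 1 - t := by linarith
  have hts : 0 < t - s := by linarith
  have hα : 0 < √(s * (1 - s)) := Real.sqrt_pos.mpr (by positivity)
  have hα2 : √(s * (1 - s)) ^ 2 = s * (1 - s) := Real.sq_sqrt (by positivity)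
  have hγ : 0 < √((1 - t) * (t - s) / (1 - s)) := Real.sqrt_pos.mpr (by positivity)
  have hγ2 : √((1 - t) * (t - s) / (1 - s)) ^ 2 = (1 - t) * (t - s) / (1 - s) :=
    Real.sq_sqrt (by positivity)
  -- `α`, `β`, `γ` are the entries of the Cholesky factor of the bridge covariance at `s`, `t`.
  set α := √(s * (1 - s)) with hαdef
  set γ := √((1 - t) * (t - s) / (1 - s)) with hγdef
  set β := s * (1 - t) / α with hβdef
  have hαβ : α * β = s * (1 - t) := by rw [hβdef]; field_simp
  have hβ2 : β ^ 2 = s * (1 - t) ^ 2 / (1 - s) := by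
    rw [hβdef, div_pow, hα2]
    field_simp
  have hβγ : β ^ 2 + γ ^ 2 = t * (1 - t) := by
    rw [hβ2, hγ2]
    field_simp
    ring
  refine ⟨fun z => ![α * z.1, β * z.1 + γ * z.2], ⟨?_, fun v => ?_⟩, ?_⟩
  · refine (measurable_pi_lambda _ fun j => ?_).aemeasurable
    fin_cases j <;> simp <;> fun_prop
  · have hfun : (fun z : ℝ × ℝ => ∑ j, v j * (![α * z.1, β * z.1 + γ * z.2] : Fin 2 → ℝ) j) =
        fun z => (v 0 * α + v 1 * β) * z.1 + v 1 * γ * z.2 := by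
      funext z
      simp only [Fin.sum_univ_two, Matrix.cons_val_zero, Matrix.cons_val_one]
      ring
    rw [hfun, map_linear_gaussianPair]
    congr 2
    simp only [Fin.sum_univ_two, Matrix.cons_val_zero, Matrix.cons_val_one, min_self,
      min_eq_left hst.le, min_eq_right hst.le]
    linear_combination (v 0) ^ 2 * hα2 + 2 * v 0 * v 1 * hαβ + (v 1) ^ 2 * hβγ
  · simp only [Matrix.cons_val_zero, Matrix.cons_val_one]
    rw [integral_sign_gaussianPair hα hγ, G_eq hs hts h1t]
    congr 2
    rw [eq_comm, Real.sqrt_eq_iff_mul_self_eq (by positivity) (by positivity), ← sq, div_pow, hβ2,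
      hγ2]
    field_simp
    ring

/-! ### Limits of spin correlations -/

theorem integral_sign_eq_measureReal_sub {E : Type*} [MeasurableSpace E] {ν : Measure E}
    [IsProbabilityMeasure ν] {f : E → ℝ} (hf : Measurable f) :
    ∫ x, Real.sign (f x) ∂ν = ν.real {x | 0 < f x} - ν.real {x | f x < 0} := by
  have hpos : MeasurableSet {x | 0 < f x} := measurableSet_lt measurable_const hf
  have hneg : MeasurableSet {x | f x < 0} := measurableSet_lt hf measurable_const
  have h : ∀ x, Real.sign (f x) = {x | 0 < f x}.indicator (fun _ => (1 : ℝ)) x -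
      {x | f x < 0}.indicator (fun _ => (1 : ℝ)) x := by
    intro x
    rcases lt_trichotomy (f x) 0 with hx | hx | hx
    · simp [Real.sign_of_neg hx, hx, hx.not_gt]
    · simp [hx]
    · simp [Real.sign_of_pos hx, hx, hx.not_gt]
  simp only [h]
  rw [integral_sub ((integrable_const _).indicator hpos) ((integrable_const _).indicator hneg),
    integral_indicator_const _ hpos, integral_indicator_const _ hneg]
  simp

/-- Convergence in distribution of a pair of variables gives convergence of the correlation of
their signs, if the components of the limit have no atom at `0`. -/
theorem tendsto_integral_sign_mul {Ω : ℕ → Type*} [∀ n, MeasurableSpace (Ω n)]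
    {μ : ∀ n, Measure (Ω n)} [∀ n, IsProbabilityMeasure (μ n)] {Ω' : Type*} [MeasurableSpace Ω']
    {P : Measure Ω'} [IsProbabilityMeasure P] {X : ∀ n, Ω n → Fin 2 → ℝ} {Y : Ω' → Fin 2 → ℝ}
    (h : TendstoInDistribution X atTop Y μ P) (h0 : ∀ j, ∀ᵐ ω ∂P, Y ω j ≠ 0) :
    Tendsto (fun n => ∫ ω, Real.sign (X n ω 0 * X n ω 1) ∂μ n) atTop
      (𝓝 (∫ ω, Real.sign (Y ω 0 * Y ω 1) ∂P)) := by
  have hm : Measurable fun x : Fin 2 → ℝ => x 0 * x 1 := by fun_prop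
  have hc : Continuous fun x : Fin 2 → ℝ => x 0 * x 1 := by fun_prop
  have hX := h.forall_aemeasurable
  have hY := h.aemeasurable_limit
  have eX : ∀ n, ∫ ω, Real.sign (X n ω 0 * X n ω 1) ∂μ n =
      ∫ x : Fin 2 → ℝ, Real.sign (x 0 * x 1) ∂((μ n).map (X n)) := fun n =>
    (integral_map (hX n) (measurable_sign.comp hm).aestronglyMeasurable).symm
  have eY : ∫ ω, Real.sign (Y ω 0 * Y ω 1) ∂P =
      ∫ x : Fin 2 → ℝ, Real.sign (x 0 * x 1) ∂(P.map Y) :=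
    (integral_map hY (measurable_sign.comp hm).aestronglyMeasurable).symm
  have hpX : ∀ n, IsProbabilityMeasure ((μ n).map (X n)) := fun n =>
    Measure.isProbabilityMeasure_map (hX n)
  have hpY : IsProbabilityMeasure (P.map Y) := Measure.isProbabilityMeasure_map hY
  simp only [eX]
  rw [eY, integral_sign_eq_measureReal_sub hm]
  simp only [integral_sign_eq_measureReal_sub hm]
  -- The frontiers of `{x 0 * x 1 > 0}` and `{x 0 * x 1 < 0}` lie in this null set, so the
  -- portmanteau theorem applies to both.
  have hnull : (P.map Y) {x : Fin 2 → ℝ | x 0 * x 1 = 0} = 0 := by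
    rw [Measure.map_apply_of_aemeasurable hY (measurableSet_eq_fun hm measurable_const)]
    have : ∀ᵐ ω ∂P, Y ω 0 * Y ω 1 ≠ 0 := by
      filter_upwards [h0 0, h0 1] with ω ha hb using mul_ne_zero ha hb
    exact measure_eq_zero_iff_ae_notMem.mpr this
  have hlim : ∀ E : Set (Fin 2 → ℝ), frontier E ⊆ {x | x 0 * x 1 = 0} →
      Tendsto (fun n => ((μ n).map (X n)).real E) atTop (𝓝 ((P.map Y).real E)) := fun E hE =>
    (ENNReal.tendsto_toReal (measure_ne_top _ _)).comp
      (ProbabilityMeasure.tendsto_measure_of_null_frontier_of_tendsto' h.tendsto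
        (measure_mono_null hE hnull))
  refine (hlim _ ?_).sub (hlim _ ?_)
  · exact (frontier_lt_subset_eq continuous_const hc).trans fun x hx => Eq.symm hx
  · exact frontier_lt_subset_eq hc continuous_const

theorem IsBridgeVector.ae_ne_zero {k : ℕ} {t : Fin k → ℝ} {Ω : Type*} [MeasurableSpace Ω]
    {Y : Ω → Fin k → ℝ} {P : Measure Ω} (hY : IsBridgeVector t Y P) {j : Fin k}
    (hj : t j ∈ Ioo (0 : ℝ) 1) : ∀ᵐ ω ∂P, Y ω j ≠ 0 := by
  have h := hY.map_sum (Pi.single j 1)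
  have hv : (∑ a, ∑ b, (Pi.single j 1 : Fin k → ℝ) a * (Pi.single j 1 : Fin k → ℝ) b *
      (min (t a) (t b) - t a * t b)) = t j * (1 - t j) := by
    simp [Pi.single_apply]
    ring
  have hne : (t j * (1 - t j)).toNNReal ≠ 0 := by
    have : 0 < t j * (1 - t j) := mul_pos hj.1 (by linarith [hj.2])
    simpa using this
  have := nullSingletonClass_gaussianReal (μ := 0) hne
  rw [hv] at h
  have hYj : (fun ω => ∑ a, (Pi.single j 1 : Fin k → ℝ) a * Y ω a) = fun ω => Y ω j := by
    funext ω
    simp [Pi.single_apply]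
  rw [hYj] at h
  have hz : (P.map fun ω => Y ω j) {0} = 0 := by rw [h]; exact measure_singleton 0
  have hYm := hY.aemeasurable
  rw [Measure.map_apply_of_aemeasurable (by fun_prop) (measurableSet_singleton 0)] at hz
  exact measure_eq_zero_iff_ae_notMem.mp hz

theorem div_abs_eq_sign (x : ℝ) : x / |x| = Real.sign x := by
  rcases lt_trichotomy x 0 with hx | rfl | hx
  · rw [Real.sign_of_neg hx, abs_of_neg hx, div_neg, div_self hx.ne]
  · simp
  · rw [Real.sign_of_pos hx, abs_of_pos hx, div_self hx.ne']

theorem spin_mul_spin (p : ℝ) {L : ℕ} (b : Fin L → ℝ) (i j : Fin L) :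
    spin p b i * spin p b j = Real.sign (displacement p b i * displacement p b j) := by
  rw [← div_abs_eq_sign, abs_mul, spin, spin, div_mul_div_comm]

/-- The spin–spin correlation, for natural indices (with value `0` out of range). -/
noncomputable def spinCorrNat (p : ℝ) (L m n : ℕ) : ℝ :=
  if h : m < L ∧ n < L then spinCorr p L ⟨m, h.1⟩ ⟨n, h.2⟩ else 0

theorem abs_spinCorr_le_one (p : ℝ) (L : ℕ) (i j : Fin L) : |spinCorr p L i j| ≤ 1 := by
  unfold spinCorr
  simp only [spin_mul_spin]
  have h := norm_integral_le_of_norm_le_const (μ := blueLaw L) (C := 1)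
    (f := fun b => Real.sign (displacement p b i * displacement p b j))
    (Eventually.of_forall fun b => abs_sign_le_one _)
  simpa using h

theorem abs_spinCorrNat_le_one (p : ℝ) (L m n : ℕ) : |spinCorrNat p L m n| ≤ 1 := by
  unfold spinCorrNat
  split_ifs
  · exact abs_spinCorr_le_one _ _ _ _
  · simp

section SpinLimit

variable {p s t : ℝ} {i j : ℕ → ℕ}

theorem eventually_lt_of_tendsto_div (ht : t < 1)
    (hi : Tendsto (fun L => (i L : ℝ) / L) atTop (𝓝 t)) : ∀ᶠ L in atTop, i L < L := by
  filter_upwards [hi.eventually_lt_const ht, eventually_gt_atTop 0] with L h hL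
  rwa [div_lt_one (Nat.cast_pos.mpr hL), Nat.cast_lt] at h

theorem tendsto_spinCorrNat_integral_sign (hp : 1 < p) (hs : 0 < s) (hst : s < t) (ht : t < 1)
    (hi : Tendsto (fun L => (i L : ℝ) / L) atTop (𝓝 s))
    (hj : Tendsto (fun L => (j L : ℝ) / L) atTop (𝓝 t))
    {Ω : Type*} [MeasurableSpace Ω] {P : Measure Ω} [IsProbabilityMeasure P]
    {Y : Ω → Fin 2 → ℝ} (hY : IsBridgeVector ![s, t] Y P) :
    Tendsto (fun L => spinCorrNat p L (i L) (j L)) atTop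
      (𝓝 (∫ ω, Real.sign (Y ω 0 * Y ω 1) ∂P)) := by
  have hiL := eventually_lt_of_tendsto_div (hst.trans ht) hi
  have hjL := eventually_lt_of_tendsto_div ht hj
  have hmem : ∀ a, (![s, t] : Fin 2 → ℝ) a ∈ Ioo (0 : ℝ) 1 := by
    intro a
    fin_cases a
    · exact ⟨hs, hst.trans ht⟩
    · exact ⟨hs.trans hst, ht⟩
  have h := tendstoInDistribution_displacement (i := ![i, j]) hp
    (fun a => Ioo_subset_Icc_self (hmem a))
    (by intro a; fin_cases a; exacts [hiL, hjL])
    (by intro a; fin_cases a; exacts [hi, hj]) 0 hY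
  refine (tendsto_integral_sign_mul h fun a =>
    hY.ae_ne_zero (hmem a)).congr' ?_
  filter_upwards [hiL, hjL] with L hiL hjL
  have hL : (0 : ℝ) < L := Nat.cast_pos.mpr (Nat.zero_lt_of_lt hiL)
  rw [spinCorrNat, dif_pos ⟨hiL, hjL⟩, spinCorr]
  refine integral_congr_ae (Eventually.of_forall fun b => ?_)
  simp only [Matrix.cons_val_zero, Matrix.cons_val_one, hiL, hjL, dif_pos, sub_zero,
    spin_mul_spin]
  rw [div_mul_div_comm, Real.mul_self_sqrt hL.le, div_eq_inv_mul,
    sign_mul_of_pos (inv_pos.mpr hL)]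

theorem tendsto_spinCorrNat (hp : 1 < p) (hs : 0 < s) (hst : s < t) (ht : t < 1)
    (hi : Tendsto (fun L => (i L : ℝ) / L) atTop (𝓝 s))
    (hj : Tendsto (fun L => (j L : ℝ) / L) atTop (𝓝 t)) :
    Tendsto (fun L => spinCorrNat p L (i L) (j L)) atTop (𝓝 (G s (t - s) (1 - t))) := by
  obtain ⟨Y, hY, hG⟩ := exists_isBridgeVector_pair hs hst ht
  exact hG ▸ tendsto_spinCorrNat_integral_sign hp hs hst ht hi hj hY

end SpinLimit

/-! ### Rescaled times and the bridge -/

theorem tendsto_floor_mul_div {n : ℕ → ℕ} {c : ℝ}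
    (hn : Tendsto (fun L => (n L : ℝ) / L) atTop (𝓝 c)) {u : ℝ} (hu : 0 ≤ u) :
    Tendsto (fun L => (⌊u * n L⌋₊ : ℝ) / L) atTop (𝓝 (u * c)) := by
  have h1 : Tendsto (fun L => u * ((n L : ℝ) / L)) atTop (𝓝 (u * c)) := hn.const_mul u
  have h2 : Tendsto (fun L : ℕ => u * ((n L : ℝ) / L) - 1 / (L : ℝ)) atTop (𝓝 (u * c)) := by
    simpa using h1.sub (tendsto_const_div_atTop_nhds_zero_nat (1 : ℝ))
  refine tendsto_of_tendsto_of_tendsto_of_le_of_le h2 h1 (fun L => ?_) fun L => ?_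
  · simp only
    rw [mul_div_assoc', ← sub_div]
    gcongr
    linarith [Nat.lt_floor_add_one (u * n L)]
  · simp only
    rw [mul_div_assoc']
    gcongr
    exact Nat.floor_le (by positivity)

theorem tendsto_timeIndex_div {s : ℝ} (hs : s ∈ Icc (0 : ℝ) 1) :
    Tendsto (fun L : ℕ => ((min ⌊s * L⌋₊ (L - 1) : ℕ) : ℝ) / L) atTop (𝓝 s) := by
  have h2 : Tendsto (fun L : ℕ => s - 1 / (L : ℝ)) atTop (𝓝 s) := by
    simpa using (tendsto_const_nhds (x := s)).sub (tendsto_const_div_atTop_nhds_zero_nat (1 : ℝ))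
  refine tendsto_of_tendsto_of_tendsto_of_le_of_le' h2 tendsto_const_nhds ?_ ?_
  · filter_upwards [eventually_gt_atTop 0] with L hL
    have hL' : (0 : ℝ) < L := Nat.cast_pos.mpr hL
    rw [le_div_iff₀ hL', sub_mul, one_div, inv_mul_cancel₀ hL'.ne', Nat.cast_min,
      Nat.cast_pred hL]
    refine le_min (by linarith [Nat.lt_floor_add_one (s * L)]) ?_
    nlinarith [hs.2]
  · filter_upwards [eventually_gt_atTop 0] with L hL
    have hL' : (0 : ℝ) < L := Nat.cast_pos.mpr hL
    rw [div_le_iff₀ hL', Nat.cast_min]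
    exact (min_le_left _ _).trans (Nat.floor_le (mul_nonneg hs.1 hL'.le))

theorem tendstoInDistribution_rescaledDisplacement {p : ℝ} (hp : 1 < p) {Ω : Type*}
    [MeasurableSpace Ω] {P : Measure Ω} [IsProbabilityMeasure P] {B : I → Ω → ℝ}
    (hB : IsBrownianBridge B P) {k : ℕ} (t : Fin k → I) :
    TendstoInDistribution
      (fun (L : ℕ) (b : Fin L → ℝ) (j : Fin k) => rescaledDisplacement p b (t j))
      atTop (fun (ω : Ω) (j : Fin k) => B (t j) ω) blueLaw P := by
  have h := tendstoInDistribution_displacement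
    (i := fun j L => min ⌊(t j : ℝ) * L⌋₊ (L - 1)) hp (fun j => (t j).2)
    (fun j => (eventually_gt_atTop 0).mono fun L hL => (min_le_right _ _).trans_lt (by omega))
    (fun j => tendsto_timeIndex_div (t j).2) (1 / 2) (hB.isBridgeVector t)
  refine h.congr (fun L => Eventually.of_forall fun b => ?_) (EventuallyEq.refl _ _)
  funext j
  simp only [rescaledDisplacement, timeIndex]
  rcases Nat.eq_zero_or_pos L with rfl | hL
  · simp
  · have : min ⌊(t j : ℝ) * L⌋₊ (L - 1) < L := (min_le_right _ _).trans_lt (by omega)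
    rw [dif_pos this, dif_pos hL]

theorem scaledSpinCorr_eq_spinCorrNat (p : ℝ) (L : ℕ) (s t : ℝ) :
    scaledSpinCorr p L s t =
      spinCorrNat p L (min ⌊s * L⌋₊ (L - 1)) (min ⌊t * L⌋₊ (L - 1)) := by
  rcases Nat.eq_zero_or_pos L with rfl | hL
  · simp [scaledSpinCorr, spinCorrNat]
  · have h : ∀ m, min m (L - 1) < L := fun m => (min_le_right _ _).trans_lt (by omega)
    rw [scaledSpinCorr, dif_pos hL, spinCorrNat, dif_pos ⟨h _, h _⟩]
    rfl

theorem tendsto_scaledSpinCorr {p s t : ℝ} (hp : 1 < p) (hs : 0 < s) (hst : s < t) (ht : t < 1) :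
    Tendsto (fun L : ℕ => scaledSpinCorr p L s t) atTop (𝓝 (G s (t - s) (1 - t))) := by
  simp only [scaledSpinCorr_eq_spinCorrNat]
  exact tendsto_spinCorrNat hp hs hst ht (tendsto_timeIndex_div ⟨hs.le, (hst.trans ht).le⟩)
    (tendsto_timeIndex_div ⟨(hs.trans hst).le, ht.le⟩)

/-- The same spin correlations converge to the sign correlation of this bridge and to that of the
explicit pair, so uniqueness of limits identifies the two; any exponent above `1`, here `2`, would
do. -/
theorem IsBrownianBridge.integral_sign_mul {Ω : Type*} [MeasurableSpace Ω] {P : Measure Ω}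
    [IsProbabilityMeasure P] {B : I → Ω → ℝ} (hB : IsBrownianBridge B P) {s t : I}
    (hs : 0 < (s : ℝ)) (hst : (s : ℝ) < t) (ht : (t : ℝ) < 1) :
    ∫ ω, Real.sign (B s ω * B t ω) ∂P = G s (t - s) (1 - t) := by
  have hY : IsBridgeVector ![(s : ℝ), t] (fun ω j => B (![s, t] j) ω) P := by
    convert hB.isBridgeVector ![s, t] using 1
    funext j
    fin_cases j <;> rfl
  have hs' := tendsto_timeIndex_div ⟨hs.le, (hst.trans ht).le⟩
  have ht' := tendsto_timeIndex_div ⟨(hs.trans hst).le, ht.le⟩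
  exact tendsto_nhds_unique
    (tendsto_spinCorrNat_integral_sign one_lt_two hs hst ht hs' ht' hY)
    (tendsto_spinCorrNat one_lt_two hs hst ht hs' ht')

/-! ### Averaging over pairs at fixed distance -/

theorem red_sub_red {L : ℕ} (i j : Fin L) : red i - red j = (i : ℝ) - j := by
  simp [red]

theorem mem_pairsAt {L r : ℕ} {x : Fin L × Fin L} :
    x ∈ pairsAt L r ↔ (x.2 : ℕ) = x.1 + r ∨ (x.1 : ℕ) = x.2 + r := by
  simp only [pairsAt, Finset.mem_filter, Finset.mem_univ, true_and, red_sub_red]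
  rw [abs_eq (Nat.cast_nonneg r), or_comm, sub_eq_iff_eq_add', sub_eq_iff_eq_add',
    ← sub_eq_add_neg, eq_sub_iff_add_eq, eq_comm]
  norm_cast

/-- The pairs are ordered, and `r > 0` makes the two orders disjoint. The factor `2` later cancels
against the one in the cardinality. -/
theorem sum_pairsAt {L r : ℕ} (hr : 0 < r) {g : ℕ → ℕ → ℝ} (hg : ∀ m n, g m n = g n m) :
    ∑ x ∈ pairsAt L r, g x.1 x.2 = 2 * ∑ m ∈ Finset.range (L - r), g m (m + r) := by
  classical
  have hsplit : pairsAt L r =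
      (Finset.univ.filter fun x : Fin L × Fin L => (x.2 : ℕ) = x.1 + r) ∪
        Finset.univ.filter fun x : Fin L × Fin L => (x.1 : ℕ) = x.2 + r := by
    ext x
    simp [mem_pairsAt]
  have hdisj : Disjoint (Finset.univ.filter fun x : Fin L × Fin L => (x.2 : ℕ) = x.1 + r)
      (Finset.univ.filter fun x : Fin L × Fin L => (x.1 : ℕ) = x.2 + r) := by
    rw [Finset.disjoint_filter]
    intro x _ h1 h2
    omega
  have h1 : ∑ x ∈ Finset.univ.filter (fun x : Fin L × Fin L => (x.2 : ℕ) = x.1 + r),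
      g x.1 x.2 = ∑ m ∈ Finset.range (L - r), g m (m + r) := by
    refine Finset.sum_nbij (fun x => (x.1 : ℕ)) ?_ ?_ ?_ ?_
    · intro x hx
      have := (Finset.mem_filter.mp hx).2
      have := x.2.2
      exact Finset.mem_range.mpr (by omega)
    · intro x hx y hy hxy
      have h1 := (Finset.mem_filter.mp hx).2
      have h2 := (Finset.mem_filter.mp hy).2
      simp only at hxy
      exact Prod.ext (Fin.ext hxy) (Fin.ext (by omega))
    · intro m hm
      have := Finset.mem_range.mp hm
      exact ⟨(⟨m, by omega⟩, ⟨m + r, by omega⟩), by simp, rfl⟩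
    · intro x hx
      rw [(Finset.mem_filter.mp hx).2]
  have h2 : ∑ x ∈ Finset.univ.filter (fun x : Fin L × Fin L => (x.1 : ℕ) = x.2 + r),
      g x.1 x.2 = ∑ m ∈ Finset.range (L - r), g m (m + r) := by
    rw [← h1]
    refine Finset.sum_equiv (Equiv.prodComm _ _) (fun x => by simp) fun x _ => ?_
    exact hg _ _
  rw [hsplit, Finset.sum_union hdisj, h1, h2, two_mul]

theorem spinCorrNat_comm (p : ℝ) (L m n : ℕ) : spinCorrNat p L m n = spinCorrNat p L n m := by
  have h : ∀ i j : Fin L, spinCorr p L i j = spinCorr p L j i := fun i j => by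
    simp only [spinCorr, mul_comm]
  unfold spinCorrNat
  split_ifs with h1 h2 h2
  · exact h _ _
  · exact absurd h1.symm h2
  · exact absurd h2.symm h1
  · rfl

theorem avgSpinCorr_eq {p : ℝ} {L r : ℕ} (hr : 0 < r) :
    avgSpinCorr p L r =
      (∑ m ∈ Finset.range (L - r), spinCorrNat p L m (m + r)) / (L - r : ℕ) := by
  have h1 := sum_pairsAt (L := L) hr (spinCorrNat_comm p L)
  have h2 := sum_pairsAt (L := L) hr (g := fun _ _ => 1) fun _ _ => rfl
  simp only [Finset.sum_const, nsmul_eq_mul, mul_one, Finset.card_range] at h2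
  have h3 : ∀ x : Fin L × Fin L, spinCorrNat p L x.1 x.2 = spinCorr p L x.1 x.2 := fun x =>
    dif_pos ⟨x.1.2, x.2.2⟩
  simp only [h3] at h1
  rw [avgSpinCorr, h1, h2, mul_div_mul_left _ _ two_ne_zero]

theorem intervalIntegral_floor {f : ℕ → ℝ} {n : ℕ} :
    ∫ x in (0 : ℝ)..n, f ⌊x⌋₊ = ∑ m ∈ Finset.range n, f m := by
  have hfloor : ∀ m : ℕ, EqOn (fun x : ℝ => f ⌊x⌋₊) (fun _ => f m) (Ioo (m : ℝ) (m + 1)) := by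
    intro m x hx
    simp only
    rw [(Nat.floor_eq_iff ((Nat.cast_nonneg m).trans hx.1.le)).mpr ⟨hx.1.le, hx.2⟩]
  have hint : ∀ m < n, IntervalIntegrable (fun x : ℝ => f ⌊x⌋₊) volume ((m : ℕ) : ℝ)
      ((m + 1 : ℕ) : ℝ) := by
    intro m _
    push_cast
    rw [intervalIntegrable_iff_integrableOn_Ioo_of_le (by linarith)]
    exact (integrableOn_const (by simp)).congr_fun (hfloor m).symm measurableSet_Ioo
  have h := intervalIntegral.sum_integral_adjacent_intervals (a := fun m : ℕ => (m : ℝ)) hint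
  simp only [Nat.cast_zero] at h
  rw [← h]
  refine Finset.sum_congr rfl fun m _ => ?_
  push_cast
  rw [intervalIntegral.integral_of_le (by linarith), integral_Ioc_eq_integral_Ioo,
    setIntegral_congr_fun measurableSet_Ioo (hfloor m)]
  simp

/-- Writing the average as an integral over the fixed interval `[0, 1]` prepares it for dominated
convergence. -/
theorem intervalIntegral_floor_mul {f : ℕ → ℝ} {n : ℕ} (hn : 0 < n) :
    ∫ u in (0 : ℝ)..1, f ⌊u * n⌋₊ = (∑ m ∈ Finset.range n, f m) / n := by
  have h := intervalIntegral.integral_comp_mul_right (a := 0) (b := 1) (fun x : ℝ => f ⌊x⌋₊)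
    (Nat.cast_ne_zero (R := ℝ).mpr hn.ne')
  rw [h, zero_mul, one_mul, intervalIntegral_floor, smul_eq_mul, div_eq_inv_mul]

theorem intervalIntegral_G_eq_Gobc {b : ℝ} (hb : b < 1) :
    ∫ u in (0 : ℝ)..1, G (u * (1 - b)) b (1 - u * (1 - b) - b) = Gobc b := by
  have h := intervalIntegral.integral_comp_mul_right (a := 0) (b := 1)
    (fun a : ℝ => G a b (1 - a - b)) (sub_ne_zero.mpr hb.ne')
  rw [h, zero_mul, one_mul, smul_eq_mul, Gobc, one_div]

theorem tendsto_avgSpinCorr {p b : ℝ} (hp : 1 < p) (hb0 : 0 < b) (hb1 : b < 1) {r : ℕ → ℕ}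
    (hr : Tendsto (fun L : ℕ => (r L : ℝ) / L) atTop (𝓝 b)) :
    Tendsto (fun L : ℕ => avgSpinCorr p L (r L)) atTop (𝓝 (Gobc b)) := by
  have hrL := eventually_lt_of_tendsto_div hb1 hr
  have hr0 : ∀ᶠ L in atTop, 0 < r L := by
    filter_upwards [hr.eventually_const_lt hb0] with L h
    rcases Nat.eq_zero_or_pos (r L) with h0 | h0
    · simp [h0] at h
    · exact h0
  have hn : Tendsto (fun L : ℕ => ((L - r L : ℕ) : ℝ) / L) atTop (𝓝 (1 - b)) := by
    refine (hr.const_sub 1).congr' ?_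
    filter_upwards [hrL] with L h
    have hL : (L : ℝ) ≠ 0 := Nat.cast_ne_zero.mpr (by omega)
    rw [Nat.cast_sub h.le, sub_div, div_self hL]
  rw [← intervalIntegral_G_eq_Gobc hb1]
  have hlim : Tendsto (fun L : ℕ => ∫ u in (0 : ℝ)..1,
      spinCorrNat p L ⌊u * (L - r L : ℕ)⌋₊ (⌊u * (L - r L : ℕ)⌋₊ + r L)) atTop
      (𝓝 (∫ u in (0 : ℝ)..1, G (u * (1 - b)) b (1 - u * (1 - b) - b))) := by
    refine intervalIntegral.tendsto_integral_filter_of_dominated_convergence (fun _ => 1)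
      (Eventually.of_forall fun L => ?_)
      (Eventually.of_forall fun L => Eventually.of_forall fun u _ => abs_spinCorrNat_le_one _ _ _ _)
      intervalIntegrable_const ?_
    · exact ((measurable_from_nat (f := fun m => spinCorrNat p L m (m + r L))).comp
        (Nat.measurable_floor.comp (measurable_id.mul_const _))).aestronglyMeasurable
    -- At `u = 1` the right-hand time `u (1 - b) + b` reaches the end of the bridge; this point is
    -- null.
    · filter_upwards [compl_mem_ae_iff.mpr (measure_singleton (1 : ℝ))] with u hu1 hu
      rw [uIoc_of_le zero_le_one] at hu
      have hu1 : u < 1 := hu.2.lt_of_ne hu1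
      have h1b : 0 < 1 - b := by linarith
      have hi := tendsto_floor_mul_div hn hu.1.le
      have hj : Tendsto (fun L : ℕ => ((⌊u * (L - r L : ℕ)⌋₊ + r L : ℕ) : ℝ) / L) atTop
          (𝓝 (u * (1 - b) + b)) := by
        simpa only [Nat.cast_add, add_div] using hi.add hr
      have h := tendsto_spinCorrNat hp (mul_pos hu.1 h1b) (by linarith) (by nlinarith) hi hj
      rwa [add_sub_cancel_left, ← sub_sub] at h
  refine hlim.congr' ?_
  filter_upwards [hrL, hr0] with L h h0
  rw [avgSpinCorr_eq h0]
  exact intervalIntegral_floor_mul (f := fun m => spinCorrNat p L m (m + r L)) (by omega)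

end GridPoisson

theorem mainTheorem1 (p : ℝ) (hp : 1 < p) :
    -- almost surely the optimal matching is unique, and it is the ordered one
    (∀ L : ℕ, (∀ᵐ b ∂(GridPoisson.blueLaw L), Function.Injective b) ∧
      ∀ b : Fin L → ℝ, Function.Injective b → ∃ π : Equiv.Perm (Fin L),
        (∀ π', GridPoisson.IsOrdered b π' ↔ π' = π) ∧
        (∀ π', GridPoisson.IsOptimal p b π' ↔ π' = π)) ∧
    -- the rescaled displacements converge jointly in law to a Brownian bridge
    (∀ (Ω : Type*) [MeasurableSpace Ω] (P : Measure Ω) [IsProbabilityMeasure P]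
        (B : unitInterval → Ω → ℝ), GridPoisson.IsBrownianBridge B P →
      (∀ (k : ℕ) (t : Fin k → unitInterval),
        TendstoInDistribution
          (fun (L : ℕ) (b : Fin L → ℝ) (j : Fin k) =>
            GridPoisson.rescaledDisplacement p b (t j))
          atTop (fun (ω : Ω) (j : Fin k) => B (t j) ω) GridPoisson.blueLaw P) ∧
      -- the correlation of the signs of the bridge is `G`
      (∀ s t : unitInterval, 0 < (s : ℝ) → (s : ℝ) < t → (t : ℝ) < 1 →
        ∫ ω, Real.sign (B s ω * B t ω) ∂P = GridPoisson.G s (t - s) (1 - t))) ∧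
    -- the spin correlation at rescaled times `a` and `a + b` converges to `G`
    (∀ a b c : ℝ, 0 < a → 0 < b → 0 < c → a + b + c = 1 →
      Tendsto (fun L : ℕ => GridPoisson.scaledSpinCorr p L a (a + b)) atTop
        (𝓝 (GridPoisson.G a b c))) ∧
    -- the closed form of `G`, without the constraint `a + b + c = 1`
    (∀ a b c : ℝ, 0 < a → 0 < b → 0 < c →
      GridPoisson.G a b c = 2 / Real.pi * Real.arctan √(a * c / (b * (a + b + c)))) ∧
    -- the average over positions at fixed separation
    (∀ b : ℝ, 0 < b → b < 1 →
      GridPoisson.Gobc b = (1 - √b) / (1 + √b) ∧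
      ∀ r : ℕ → ℕ, Tendsto (fun L : ℕ => (r L : ℝ) / L) atTop (𝓝 b) →
        Tendsto (fun L : ℕ => GridPoisson.avgSpinCorr p L (r L)) atTop
          (𝓝 (GridPoisson.Gobc b))) := by
  refine ⟨fun L => ⟨GridPoisson.ae_injective_blueLaw L, fun b hb => ⟨Tuple.sort b,
    fun π' => GridPoisson.isOrdered_iff_eq_sort hb,
    fun π' => GridPoisson.isOptimal_iff_eq_sort hp hb⟩⟩, ?_, ?_, ?_, ?_⟩
  · intro Ω _ P _ B hB
    exact ⟨fun k t => GridPoisson.tendstoInDistribution_rescaledDisplacement hp hB t,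
      fun s t hs hst ht => hB.integral_sign_mul hs hst ht⟩
  · intro a b c ha hb hc habc
    have h := GridPoisson.tendsto_scaledSpinCorr (s := a) (t := a + b) hp ha (by linarith)
      (by linarith)
    rwa [add_sub_cancel_left, show 1 - (a + b) = c by linarith] at h
  · exact fun a b c ha hb hc => GridPoisson.G_eq ha hb hc
  · exact fun b hb0 hb1 => ⟨GridPoisson.Gobc_eq hb0 hb1,
      fun r hr => GridPoisson.tendsto_avgSpinCorr hp hb0 hb1 hr⟩
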